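/- Let $n\ge 1$ and let $\mathbf d=(d_1,\dots,d_s)$ be integers with $1\le d_1<\dots<d_s\le n$. Let $V$ be a complex vector space with basis $f_1,\dots,f_{n+1}$, let $\mathrm{pr}_k:V\to V$ be the linear map with $\mathrm{pr}_k(f_k)=0$ and $\mathrm{pr}_k(f_j)=f_j$ for $j\ne k$, and put $\mathrm{pr}_{i,j}=\mathrm{pr}_{j-1}\circ\dots\circ\mathrm{pr}_{i+1}\circ\mathrm{pr}_i$ for $i<j$. The partial degenerate flag variety is the closed subvariety $$\mathcal{F}l^a_{\mathbf d}=\Big\{(V_1,\dots,V_s)\in\prod_{l=1}^s\mathrm{Gr}_{d_l}(V)\ \Big|\ \mathrm{pr}_{d_l,d_{l+1}}(V_l)\subseteq V_{l+1}\ \text{ for } 1\le l<s\Big\}$$ of the product of Grassmannians. Let $B\subset SL_{2n}=SL_{2n}(\mathbb C)$ be the subgroup of upper triangular matrices and $T\subset B$ the torus of diagonal matrices. Let $\omega_1,\dots,\omega_{2n-1}$ be the fundamental weights of $SL_{2n}$, let $\lambda=\sum_{i=1}^s\omega_{2d_i-1}$, and let $P_\lambda\supseteq B$ be the corresponding parabolic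 subgroup (the stabilizer of the flag of coordinate subspaces $\langle e_1,\dots,e_{2d_i-1}\rangle$, $1\le i\le s$, of $\mathbb C^{2n}$). For a permutation $\tau\in \mathrm{Sym}_{2n}$ let $X_\tau=\overline{B\tau P_\lambda/P_\lambda}\subset SL_{2n}/P_\lambda$ be the associated Schubert variety, with its reduced structure, where $\tau$ is represented by a monomial matrix sending each $e_j$ to a nonzero multiple of $e_{\tau(j)}$. The group $T$ acts on it by left multiplication. An element $t=\mathrm{diag}(t_1,\dots,t_{2n})\in T$ acts on $\mathcal{F}l^a_{\mathbf d}$ by $t\cdot(V_1,\dots,V_s)=(t^{(d_1)}V_1,\dots,t^{(d_s)}V_s)$, where $t^{(i)}$ is the linear automorphism of $V$ given by $$t^{(i)}f_k=\begin{cases}t_k f_k & \text{if } i\le k\le n+1,\\ t_{n+1+k}f_k & \text{if } 1\le k\le i-1.\end{cases}$$ Let $\sigma_n\in\mathrm{Sym}_{2n}$ be the permutation with $\sigma_n(2k)=k$ for $1\le k\le n$ and $\sigma_n(2k+1)=n+1+k$ for $0\le k\le n-1$, let $W_J\subseteq\mathrm{Sym}_{2n}$ be the subgroup generated by the transpositions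 $(k,k+1)$ with $1\le k\le 2n-1$ and $k\notin\{2d_1-1,\dots,2d_s-1\}$, and let $\sigma_{\mathbf d}$ be the representative of minimal length of the coset $\sigma_nW_J$. Theorem. There exists a $T$-equivariant isomorphism of varieties $$\zeta:\mathcal{F}l^a_{\mathbf d}\ \xrightarrow{\ \simeq\ }\ X_{\sigma_{\mathbf d}}\subset SL_{2n}/P_\lambda .$$ -/

import Mathlib

open Filter Topology

namespace DegFlag

/-! ### Varieties as spaces with functions

A classical complex variety is given by its set of closed points, its Zariski topology and its
sheaf of regular functions.  The sheaf is recorded through its germs: `RegularAt f x` says that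
the germ of `f` at `x` is regular, and the sections over an open set `U` are the functions that
are regular at every point of `U`. -/

/-- A topological space with a sheaf of `ℂ`-algebras of complex valued functions. -/
structure SpaceWithFunctions (X : Type*) where
  /-- the Zariski topology -/
  top : TopologicalSpace X
  /-- the function `f` is regular in a neighbourhood of the point `x` -/
  RegularAt : (X → ℂ) → X → Prop
  eventually : ∀ f x, RegularAt f x → ∀ᶠ y in @nhds X top x, RegularAt f y
  congr : ∀ f g x, (∀ᶠ y in @nhds X top x, f y = g y) → RegularAt f x → RegularAt g x
  const : ∀ (c : ℂ) x, RegularAt (fun _ => c) x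
  add : ∀ f g x, RegularAt f x → RegularAt g x → RegularAt (f + g) x
  mul : ∀ f g x, RegularAt f x → RegularAt g x → RegularAt (f * g) x

namespace SpaceWithFunctions

variable {X Y : Type*}

/-- Morphisms of varieties: continuous maps that pull regular functions back to regular
functions. -/
def IsMorphism (S : SpaceWithFunctions X) (S' : SpaceWithFunctions Y) (φ : X → Y) : Prop :=
  @Continuous X Y S.top S'.top φ ∧
    ∀ (x : X) (g : Y → ℂ), S'.RegularAt g (φ x) → S.RegularAt (g ∘ φ) x

/-- A bijection is an isomorphism if it and its inverse are morphisms. -/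
def IsIso (S : SpaceWithFunctions X) (S' : SpaceWithFunctions Y) (φ : X ≃ Y) : Prop :=
  S.IsMorphism S' φ ∧ S'.IsMorphism S φ.symm

/-- The (quasi-)affine structure on a set `X` of points with affine coordinates
`c : X → (ι → ℂ)`: the non-vanishing loci of polynomials are a basis of the Zariski topology, and
a function is regular at `x` if near `x` it is a quotient of two polynomials.  (The domain of
validity of the quotient may be taken to be the whole locus where the denominator does not vanish,
as one sees on multiplying both polynomials by a third one.) -/
def affine {ι : Type*} (c : X → ι → ℂ) : SpaceWithFunctions X where
  top := TopologicalSpace.generateFrom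
    {U | ∃ p : MvPolynomial ι ℂ, U = {x | MvPolynomial.eval (c x) p ≠ 0}}
  RegularAt f x := ∃ p q : MvPolynomial ι ℂ, MvPolynomial.eval (c x) q ≠ 0 ∧
    ∀ y, MvPolynomial.eval (c y) q ≠ 0 →
      f y = MvPolynomial.eval (c y) p / MvPolynomial.eval (c y) q
  eventually := by
    rintro f x ⟨p, q, hq, h⟩
    let : TopologicalSpace X := TopologicalSpace.generateFrom
      {U | ∃ p : MvPolynomial ι ℂ, U = {x | MvPolynomial.eval (c x) p ≠ 0}}
    have ho : IsOpen {x | MvPolynomial.eval (c x) q ≠ 0} :=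
      TopologicalSpace.isOpen_generateFrom_of_mem ⟨q, rfl⟩
    filter_upwards [ho.mem_nhds hq] with y hy
    exact ⟨p, q, hy, h⟩
  congr := by
    rintro f g x hfg ⟨p, q, hq, h⟩
    let : TopologicalSpace X := TopologicalSpace.generateFrom
      {U | ∃ p : MvPolynomial ι ℂ, U = {x | MvPolynomial.eval (c x) p ≠ 0}}
    have hb : TopologicalSpace.IsTopologicalBasis
        {U : Set X | ∃ p : MvPolynomial ι ℂ, U = {x | MvPolynomial.eval (c x) p ≠ 0}} := by
      refine ⟨?_, ?_, rfl⟩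
      · rintro _ ⟨a, rfl⟩ _ ⟨b, rfl⟩ z ⟨ha, hb⟩
        refine ⟨_, ⟨a * b, rfl⟩, ?_, ?_⟩
        · simpa using ⟨ha, hb⟩
        · intro w hw
          simpa using hw
      · refine Set.eq_univ_of_forall fun z => ⟨_, ⟨1, rfl⟩, by simp⟩
    obtain ⟨_, ⟨r, rfl⟩, hr, hsub⟩ := hb.mem_nhds_iff.1 hfg
    refine ⟨p * r, q * r, by simpa using ⟨hq, hr⟩, fun y hy => ?_⟩
    have hy' : MvPolynomial.eval (c y) q ≠ 0 ∧ MvPolynomial.eval (c y) r ≠ 0 := by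
      simpa using hy
    have e : f y = g y := hsub hy'.2
    rw [← e, h y hy'.1, map_mul, map_mul, mul_div_mul_right _ _ hy'.2]
  const := fun a x => ⟨MvPolynomial.C a, 1, by simp, by simp⟩
  add := by
    rintro f g x ⟨p, q, hq, h⟩ ⟨p', q', hq', h'⟩
    refine ⟨p * q' + q * p', q * q', by simpa using ⟨hq, hq'⟩, fun y hy => ?_⟩
    have hy' : MvPolynomial.eval (c y) q ≠ 0 ∧ MvPolynomial.eval (c y) q' ≠ 0 := by
      simpa using hy
    rw [Pi.add_apply, h y hy'.1, h' y hy'.2, div_add_div _ _ hy'.1 hy'.2]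
    simp
  mul := by
    rintro f g x ⟨p, q, hq, h⟩ ⟨p', q', hq', h'⟩
    refine ⟨p * p', q * q', by simpa using ⟨hq, hq'⟩, fun y hy => ?_⟩
    have hy' : MvPolynomial.eval (c y) q ≠ 0 ∧ MvPolynomial.eval (c y) q' ≠ 0 := by
      simpa using hy
    rw [Pi.mul_apply, h y hy'.1, h' y hy'.2, div_mul_div_comm]
    simp

/-- The quotient structure along `π : X → Y`: a set is open if its preimage is open, and a function
on an open set is regular if its pullback is regular on the preimage. -/
def quotient (S : SpaceWithFunctions X) (π : X → Y) : SpaceWithFunctions Y where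
  top := S.top.coinduced π
  RegularAt f y := ∀ᶠ z in @nhds Y (S.top.coinduced π) y,
    ∀ x, π x = z → S.RegularAt (f ∘ π) x
  eventually := by
    intro f y h
    exact (@eventually_eventually_nhds Y (S.top.coinduced π) y _).2 h
  congr := by
    intro f g y hfg h
    let := S.top
    let : TopologicalSpace Y := S.top.coinduced π
    have hc : Continuous π := continuous_coinduced_rng
    filter_upwards [h, eventually_eventually_nhds.2 hfg] with z hz hz' x hx
    subst hx
    exact S.congr _ _ x (hc.continuousAt.eventually hz') (hz x rfl)
  const := fun a y => Filter.Eventually.of_forall fun _ x _ => S.const a x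
  add := by
    intro f g y hf hg
    filter_upwards [hf, hg] with z h h' x hx
    exact S.add _ _ x (h x hx) (h' x hx)
  mul := by
    intro f g y hf hg
    filter_upwards [hf, hg] with z h h' x hx
    exact S.mul _ _ x (h x hx) (h' x hx)

/-- The reduced structure induced on a (locally closed) subset: the subspace topology, and the
functions that locally are restrictions of regular functions of the ambient space. -/
def sub (S : SpaceWithFunctions Y) (Z : Set Y) : SpaceWithFunctions Z where
  top := S.top.induced Subtype.val
  RegularAt f z := ∃ F : Y → ℂ, S.RegularAt F z.1 ∧
    ∀ᶠ w in @nhds Z (S.top.induced Subtype.val) z, f w = F w.1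
  eventually := by
    rintro f z ⟨F, hF, h⟩
    let := S.top
    have hc : Continuous (Subtype.val : Z → Y) := continuous_induced_dom
    filter_upwards [eventually_eventually_nhds.2 h,
      hc.continuousAt.eventually (S.eventually _ _ hF)] with w hw hw'
    exact ⟨F, hw', hw⟩
  congr := by
    rintro f g z hfg ⟨F, hF, h⟩
    refine ⟨F, hF, ?_⟩
    filter_upwards [hfg, h] with w h1 h2
    rw [← h1, h2]
  const := fun a z => ⟨fun _ => a, S.const a _, Filter.Eventually.of_forall fun _ => rfl⟩
  add := by
    rintro f g z ⟨F, hF, h⟩ ⟨G, hG, h'⟩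
    refine ⟨F + G, S.add _ _ _ hF hG, ?_⟩
    filter_upwards [h, h'] with w h1 h2
    rw [Pi.add_apply, Pi.add_apply, h1, h2]
  mul := by
    rintro f g z ⟨F, hF, h⟩ ⟨G, hG, h'⟩
    refine ⟨F * G, S.mul _ _ _ hF hG, ?_⟩
    filter_upwards [h, h'] with w h1 h2
    rw [Pi.mul_apply, Pi.mul_apply, h1, h2]

end SpaceWithFunctions

/-! ### The group `SL_{2n}`, its subgroups, and `SL_{2n} / P_λ`

All index sets are zero based: `k : Fin m` stands for the index `k + 1`. -/

/-- The special linear group `SL_{2n}(ℂ)`. -/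
abbrev SL (n : ℕ) : Type := Matrix.SpecialLinearGroup (Fin (2 * n)) ℂ

/-- The affine variety `SL_{2n}`, with the matrix entries as coordinates. -/
noncomputable def slVar (n : ℕ) : SpaceWithFunctions (SL n) :=
  SpaceWithFunctions.affine fun (g : SL n) (ij : Fin (2 * n) × Fin (2 * n)) => g.1 ij.1 ij.2

/-- The matrices in `SL_{2n}` that are block upper triangular for `b`. -/
def triSubgroup {n : ℕ} {α : Type*} [LinearOrder α] (b : Fin (2 * n) → α) : Subgroup (SL n) where
  carrier := {g | ∀ i j, b j < b i → g.1 i j = 0}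
  one_mem' := fun i j h => Matrix.one_apply_ne (by rintro rfl; exact lt_irrefl _ h)
  mul_mem' := by
    intro g h hg hh
    exact Matrix.BlockTriangular.mul (M := g.1) (N := h.1) (b := b)
      (fun i j => hg i j) (fun i j => hh i j)
  inv_mem' := by
    intro g hg i j hij
    have h1 : (g⁻¹ : SL n).1 = (g.1)⁻¹ := by
      symm
      apply Matrix.inv_eq_left_inv
      have := congrArg Subtype.val (inv_mul_cancel g)
      exact this
    let : Invertible g.1.det := by
      rw [g.2]
      exact invertibleOne
    let : Invertible g.1 := Matrix.invertibleOfDetInvertible g.1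
    rw [h1]
    exact Matrix.blockTriangular_inv_of_blockTriangular (M := g.1) (b := b)
      (fun i j => hg i j) hij

/-- The Borel subgroup of upper triangular matrices. -/
def borel (n : ℕ) : Subgroup (SL n) := triSubgroup (id : Fin (2 * n) → Fin (2 * n))

/-- The maximal torus of diagonal matrices. -/
def torus (n : ℕ) : Subgroup (SL n) where
  carrier := {g | ∀ i j, i ≠ j → g.1 i j = 0}
  one_mem' := fun _ _ h => Matrix.one_apply_ne h
  mul_mem' := by
    intro g h hg hh i j hij
    change (g.1 * h.1) i j = 0
    rw [Matrix.mul_apply]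
    refine Finset.sum_eq_zero fun k _ => ?_
    by_cases hik : i = k
    · subst hik
      rw [hh _ _ hij, mul_zero]
    · rw [hg _ _ hik, zero_mul]
  inv_mem' := by
    intro g hg i j hij
    rcases lt_or_gt_of_ne hij with h | h
    · exact (triSubgroup (n := n) (fun k : Fin (2 * n) => OrderDual.toDual k)).inv_mem
        (x := g) (fun a b hab => hg a b (by rintro rfl; exact lt_irrefl _ hab)) i j h
    · exact (triSubgroup (n := n) (fun k : Fin (2 * n) => k)).inv_mem
        (x := g) (fun a b hab => hg a b (by rintro rfl; exact lt_irrefl _ hab)) i j h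

/-- The fundamental weight `ω_k = ε_1 + ... + ε_k` of `SL_{2n}` (a representative in `ℤ^{2n}`). -/
def fundWeight (n k : ℕ) : Fin (2 * n) → ℤ := fun j => if j.1 + 1 ≤ k then 1 else 0

/-- The parabolic subgroup `P_λ` of `SL_{2n}`: it contains the torus and exactly those root
subgroups, of roots `ε_i - ε_j`, for which the pairing `λ i - λ j` of `λ` with the coroot is
nonnegative.  For a dominant weight it is the stabilizer of the highest weight line. -/
def parabolic {n : ℕ} (lam : Fin (2 * n) → ℤ) : Subgroup (SL n) := triSubgroup fun i => -lam i

/-- The weight `λ = ω_{2d_1-1} + ... + ω_{2d_s-1}`. -/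
def weight {n s : ℕ} (d : Fin s → Set.Icc 1 n) : Fin (2 * n) → ℤ :=
  ∑ i, fundWeight n (2 * (d i : ℕ) - 1)

/-- The set of points of `SL_{2n} / P_λ`. -/
abbrev PartialFlag {n s : ℕ} (d : Fin s → Set.Icc 1 n) : Type := SL n ⧸ parabolic (weight d)

/-- The quotient variety `SL_{2n} / P_λ`. -/
noncomputable def partialFlagVar {n s : ℕ} (d : Fin s → Set.Icc 1 n) :
    SpaceWithFunctions (PartialFlag d) :=
  (slVar n).quotient (fun g => (g : PartialFlag d))

/-! ### Schubert varieties -/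

/-- The Schubert cell `B τ P_λ / P_λ`.  A permutation `τ` is represented in `SL_{2n}` by the
monomial matrices `w` that map each basis vector `e_j` to a nonzero multiple of `e_{τ j}`. -/
def schubertCell {n s : ℕ} (d : Fin s → Set.Icc 1 n) (τ : Equiv.Perm (Fin (2 * n))) :
    Set (PartialFlag d) :=
  {x | ∃ b ∈ borel n, ∃ w : SL n, (∀ i j, w.1 i j ≠ 0 ↔ i = τ j) ∧
    x = ((b * w : SL n) : PartialFlag d)}

/-- The Schubert variety `X_τ`, the Zariski closure of the Schubert cell in `SL_{2n} / P_λ`. -/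
def schubert {n s : ℕ} (d : Fin s → Set.Icc 1 n) (τ : Equiv.Perm (Fin (2 * n))) :
    Set (PartialFlag d) :=
  @closure (PartialFlag d) (partialFlagVar d).top (schubertCell d τ)

/-- The variety structure of `X_τ`. -/
noncomputable def schubertVar {n s : ℕ} (d : Fin s → Set.Icc 1 n)
    (τ : Equiv.Perm (Fin (2 * n))) : SpaceWithFunctions (schubert d τ) :=
  (partialFlagVar d).sub (schubert d τ)

/-- The map underlying `σ_n`.  In one based indices, `σ_n (2k) = k` and `σ_n (2k+1) = n+1+k`. -/
def sigmaFun (n : ℕ) (r : Fin (2 * n)) : Fin (2 * n) :=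
  if r.1 % 2 = 1 then ⟨r.1 / 2, by omega⟩ else ⟨n + r.1 / 2, by omega⟩

theorem sigmaFun_injective (n : ℕ) : Function.Injective (sigmaFun n) := by
  intro a b h
  apply Fin.ext
  have ha := a.2
  have hb := b.2
  unfold sigmaFun at h
  split_ifs at h with h1 h2 h2 <;> simp only [Fin.mk.injEq] at h <;> omega

/-- The permutation `σ_n`. -/
noncomputable def sigma (n : ℕ) : Equiv.Perm (Fin (2 * n)) :=
  Equiv.ofBijective (sigmaFun n) (Finite.injective_iff_bijective.1 (sigmaFun_injective n))

/-- The parabolic subgroup `W_J` of the symmetric group, generated by the transpositions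
`(k, k+1)` with `k` not of the form `2d_i - 1` (here `k = a + 1`). -/
def weylJ {n s : ℕ} (d : Fin s → Set.Icc 1 n) : Subgroup (Equiv.Perm (Fin (2 * n))) :=
  Subgroup.closure {w | ∃ a b : Fin (2 * n), b.1 = a.1 + 1 ∧
    (∀ i, a.1 + 1 ≠ 2 * (d i : ℕ) - 1) ∧ w = Equiv.swap a b}

/-- The length of a permutation, the number of its inversions. -/
def permLength {m : ℕ} (τ : Equiv.Perm (Fin m)) : ℕ :=
  (Finset.univ.filter fun ab : Fin m × Fin m => ab.1 < ab.2 ∧ τ ab.2 < τ ab.1).card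

/-- The coset `σ_n W_J`. -/
def sigmaCoset {n s : ℕ} (d : Fin s → Set.Icc 1 n) : Set (Equiv.Perm (Fin (2 * n))) :=
  {τ | ∃ w ∈ weylJ d, τ = sigma n * w}

theorem sigmaCoset_nonempty {n s : ℕ} (d : Fin s → Set.Icc 1 n) : (sigmaCoset d).Nonempty :=
  ⟨sigma n, 1, (weylJ d).one_mem, (mul_one _).symm⟩

/-- The permutation `σ_d`, the representative of minimal length of the coset `σ_n W_J`. -/
noncomputable def sigmaD {n s : ℕ} (d : Fin s → Set.Icc 1 n) : Equiv.Perm (Fin (2 * n)) :=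
  Function.argminOn permLength (sigmaCoset d) (sigmaCoset_nonempty d)

/-! ### The partial degenerate flag variety -/

/-- The vector space `V` with its standard basis `f_1, ..., f_{n+1}`. -/
abbrev V (n : ℕ) : Type := Fin (n + 1) → ℂ

/-- The Grassmannian of `k`-dimensional subspaces of `V`. -/
abbrev Gr (k n : ℕ) : Type := {U : Submodule ℂ (V n) // Module.finrank ℂ U = k}

/-- Families of frames: for each `l`, a linearly independent family of `d_l` vectors in `V`. -/
abbrev Frames {n s : ℕ} (d : Fin s → Set.Icc 1 n) : Type :=
  ∀ l, {A : Fin (d l : ℕ) → V n // LinearIndependent ℂ A}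

/-- The product of Grassmannians `∏ Gr_{d_l}(V)`. -/
abbrev GrProd {n s : ℕ} (d : Fin s → Set.Icc 1 n) : Type := ∀ l, Gr (d l : ℕ) n

/-- Families of frames, as an open subset of an affine space. -/
noncomputable def framesVar {n s : ℕ} (d : Fin s → Set.Icc 1 n) :
    SpaceWithFunctions (Frames d) :=
  SpaceWithFunctions.affine fun (A : Frames d) (a : Σ l, Fin (d l : ℕ) × Fin (n + 1)) =>
    (A a.1).1 a.2.1 a.2.2

/-- The subspaces spanned by a family of frames. -/
def spanMap {n s : ℕ} (d : Fin s → Set.Icc 1 n) (A : Frames d) : GrProd d :=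
  fun l => ⟨Submodule.span ℂ (Set.range (A l).1), by
    rw [finrank_span_eq_card (A l).2, Fintype.card_fin]⟩

/-- The variety `∏ Gr_{d_l}(V)`, as the quotient of the families of frames by `∏ GL_{d_l}`. -/
noncomputable def grProdVar {n s : ℕ} (d : Fin s → Set.Icc 1 n) :
    SpaceWithFunctions (GrProd d) :=
  (framesVar d).quotient (spanMap d)

/-- The projection `pr_k` of `V` along `f_k` (one based `k`). -/
def pr (n k : ℕ) : V n →ₗ[ℂ] V n where
  toFun v := fun j => if j.1 + 1 = k then 0 else v j
  map_add' v w := by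
    ext j
    by_cases h : j.1 + 1 = k <;> simp [h]
  map_smul' a v := by
    ext j
    by_cases h : j.1 + 1 = k <;> simp [h]

/-- The composition `pr_{i+m-1} ∘ ... ∘ pr_{i+1} ∘ pr_i` of `m` projections. -/
def prComp (n i : ℕ) : ℕ → (V n →ₗ[ℂ] V n)
  | 0 => LinearMap.id
  | m + 1 => pr n (i + m) ∘ₗ prComp n i m

/-- The map `pr_{i,j} = pr_{j-1} ∘ ... ∘ pr_{i+1} ∘ pr_i`, for `i < j`. -/
def prSeg (n i j : ℕ) : V n →ₗ[ℂ] V n := prComp n i (j - i)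

/-- The partial degenerate flag variety: the tuples with `pr_{d_l,d_{l+1}}(V_l) ⊆ V_{l+1}`. -/
def degFlag {n s : ℕ} (d : Fin s → Set.Icc 1 n) : Set (GrProd d) :=
  {U | ∀ (l m : Fin s), m.1 = l.1 + 1 →
    (U l).1.map (prSeg n (d l : ℕ) (d m : ℕ)) ≤ (U m).1}

/-- The variety structure of the partial degenerate flag variety. -/
noncomputable def degFlagVar {n s : ℕ} (d : Fin s → Set.Icc 1 n) :
    SpaceWithFunctions (degFlag d) :=
  (grProdVar d).sub (degFlag d)

/-! ### The torus action -/

/-- The index of the diagonal entry by which the torus scales the basis vector `f_k` of the `i`-th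
copy of `V`; in one based indices it is `k` if `i ≤ k ≤ n+1` and `n+1+k` if `1 ≤ k ≤ i-1`. -/
def scaleIndex {n : ℕ} (i : Set.Icc 1 n) (k : Fin (n + 1)) : Fin (2 * n) :=
  if h : (i : ℕ) ≤ k.1 + 1 then
    ⟨k.1, by have h1 := i.2.1; have h2 := i.2.2; have h3 := k.2; omega⟩
  else ⟨n + 1 + k.1, by have h1 := i.2.1; have h2 := i.2.2; omega⟩

/-- The linear action of the torus on the `i`-th copy of `V`. -/
def torusRep {n : ℕ} (i : Set.Icc 1 n) : torus n →* Module.End ℂ (V n) where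
  toFun t :=
    { toFun := fun v k => t.1.1 (scaleIndex i k) (scaleIndex i k) * v k
      map_add' := by
        intro v w
        ext k
        simp [mul_add]
      map_smul' := by
        intro a v
        ext k
        simp only [Pi.smul_apply, smul_eq_mul, RingHom.id_apply]
        ring }
  map_one' := by
    ext v k
    simp
  map_mul' := by
    intro t u
    apply LinearMap.ext
    intro v
    funext k
    change (t.1.1 * u.1.1) (scaleIndex i k) (scaleIndex i k) * v k =
      t.1.1 (scaleIndex i k) (scaleIndex i k) * (u.1.1 (scaleIndex i k) (scaleIndex i k) * v k)
    rw [Matrix.mul_apply, Finset.sum_eq_single (scaleIndex i k), mul_assoc]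
    · intro b _ hb
      rw [t.2 _ _ hb.symm, zero_mul]
    · intro h
      exact absurd (Finset.mem_univ _) h

theorem torusRep_injective {n : ℕ} (i : Set.Icc 1 n) (t : torus n) :
    Function.Injective (torusRep i t) := by
  apply Function.LeftInverse.injective (g := torusRep i t⁻¹)
  intro v
  rw [← Module.End.mul_apply, ← map_mul, inv_mul_cancel, map_one, Module.End.one_apply]

/-- The action of the torus on `∏ Gr_{d_l}(V)`: on the factor `l` it moves subspaces of the
`d_l`-th copy of `V`. -/
instance grProdAction {n s : ℕ} (d : Fin s → Set.Icc 1 n) : MulAction (torus n) (GrProd d) where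
  smul t U := fun l => ⟨(U l).1.map (torusRep (d l) t),
    (Submodule.equivMapOfInjective _ (torusRep_injective (d l) t) (U l).1).finrank_eq.symm.trans
      (U l).2⟩
  one_smul U := by
    funext l
    apply Subtype.ext
    change (U l).1.map (torusRep (d l) 1) = (U l).1
    rw [map_one]
    exact Submodule.map_id _
  mul_smul t u U := by
    funext l
    apply Subtype.ext
    change (U l).1.map (torusRep (d l) (t * u)) =
      ((U l).1.map (torusRep (d l) u)).map (torusRep (d l) t)
    rw [map_mul]
    exact Submodule.map_comp _ _ _

theorem prComp_apply (n i m : ℕ) (v : V n) (k : Fin (n + 1)) :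
    prComp n i m v k = if i ≤ k.1 + 1 ∧ k.1 + 1 < i + m then 0 else v k := by
  induction m with
  | zero =>
    rw [if_neg (by omega)]
    rfl
  | succ m ih =>
    change (if k.1 + 1 = i + m then 0 else prComp n i m v k) = _
    rw [ih]
    split_ifs <;> first | rfl | omega

theorem prSeg_torusRep {n : ℕ} (i j : Set.Icc 1 n) (hij : i < j) (t : torus n) (v : V n) :
    prSeg n i j (torusRep i t v) = torusRep j t (prSeg n i j v) := by
  have hij' : (i : ℕ) < (j : ℕ) := hij
  funext k
  change prComp n i (j - i) (torusRep i t v) k =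
    t.1.1 (scaleIndex j k) (scaleIndex j k) * prComp n i (j - i) v k
  rw [prComp_apply, prComp_apply]
  split_ifs with h
  · rw [mul_zero]
  · have e : scaleIndex i k = scaleIndex j k := by
      unfold scaleIndex
      split_ifs <;> first | rfl | omega
    change t.1.1 (scaleIndex i k) (scaleIndex i k) * v k = _
    rw [e]

theorem smul_mem_degFlag {n s : ℕ} (d : Fin s → Set.Icc 1 n) (hd : StrictMono d) (t : torus n)
    (U : GrProd d) (hU : U ∈ degFlag d) : t • U ∈ degFlag d := by
  intro l m hlm
  change ((U l).1.map (torusRep (d l) t)).map (prSeg n (d l : ℕ) (d m : ℕ)) ≤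
    (U m).1.map (torusRep (d m) t)
  have hlt : d l < d m := hd (by rw [Fin.lt_def]; omega)
  rintro _ ⟨_, ⟨v, hv, rfl⟩, rfl⟩
  refine ⟨prSeg n (d l : ℕ) (d m : ℕ) v, hU l m hlm ⟨v, hv, rfl⟩, ?_⟩
  exact (prSeg_torusRep (d l) (d m) hlt t v).symm

theorem continuous_smul_left {n s : ℕ} (d : Fin s → Set.Icc 1 n) (g : SL n) :
    @Continuous _ _ (partialFlagVar d).top (partialFlagVar d).top
      (fun x : PartialFlag d => g • x) := by
  let : TopologicalSpace (SL n) := (slVar n).top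
  let : TopologicalSpace (PartialFlag d) := (partialFlagVar d).top
  have hmul : @Continuous _ _ (slVar n).top (slVar n).top (fun h : SL n => g * h) := by
    refine continuous_generateFrom_iff.2 ?_
    rintro _ ⟨p, rfl⟩
    refine TopologicalSpace.isOpen_generateFrom_of_mem
      ⟨MvPolynomial.bind₁ (fun ij : Fin (2 * n) × Fin (2 * n) =>
        ∑ k, MvPolynomial.C (g.1 ij.1 k) * MvPolynomial.X (k, ij.2)) p, ?_⟩
    ext h
    simp only [Set.mem_preimage, Set.mem_ofPred_eq]
    have key : MvPolynomial.eval (fun ij : Fin (2 * n) × Fin (2 * n) => h.1 ij.1 ij.2)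
        (MvPolynomial.bind₁ (fun ij : Fin (2 * n) × Fin (2 * n) =>
          ∑ k, MvPolynomial.C (g.1 ij.1 k) * MvPolynomial.X (k, ij.2)) p) =
        MvPolynomial.eval (fun ij : Fin (2 * n) × Fin (2 * n) => (g * h).1 ij.1 ij.2) p := by
      rw [← MvPolynomial.coe_aeval_eq_eval, ← MvPolynomial.coe_aeval_eq_eval]
      simp only [RingHom.coe_coe]
      rw [MvPolynomial.aeval_bind₁]
      congr 2
      funext ij
      change _ = (g.1 * h.1) ij.1 ij.2
      simp [Matrix.mul_apply]
    rw [key]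
  refine continuous_coinduced_dom.2 ?_
  exact (continuous_coinduced_rng (f := fun h : SL n => (h : PartialFlag d))).comp hmul

theorem smul_mem_schubert {n s : ℕ} (d : Fin s → Set.Icc 1 n) (τ : Equiv.Perm (Fin (2 * n)))
    (t : torus n) (x : PartialFlag d) (hx : x ∈ schubert d τ) : t.1 • x ∈ schubert d τ := by
  let : TopologicalSpace (PartialFlag d) := (partialFlagVar d).top
  refine map_mem_closure (continuous_smul_left d t.1) hx ?_
  rintro _ ⟨b, hb, w, hw, rfl⟩
  refine ⟨t.1 * b, (borel n).mul_mem ?_ hb, w, hw, ?_⟩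
  · intro i j hij
    exact t.2 i j (by rintro rfl; exact lt_irrefl _ hij)
  · rw [mul_assoc]
    rfl

/-- A torus element, moving the points of the partial degenerate flag variety. -/
def actDegFlag {n s : ℕ} (d : Fin s → Set.Icc 1 n) (hd : StrictMono d) (t : torus n)
    (U : degFlag d) : degFlag d :=
  ⟨t • U.1, smul_mem_degFlag d hd t U.1 U.2⟩

/-- A torus element, moving the points of the Schubert variety by left multiplication. -/
def actSchubert {n s : ℕ} (d : Fin s → Set.Icc 1 n) (τ : Equiv.Perm (Fin (2 * n))) (t : torus n)
    (x : schubert d τ) : schubert d τ :=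
  ⟨t.1 • x.1, smul_mem_schubert d τ t x.1 x.2⟩

end DegFlag

namespace DegFlag

namespace SpaceWithFunctions

/-! ### Regular functions -/

section General

variable {X : Type*} (S : SpaceWithFunctions X)

theorem regularAt_sum {κ : Type*} (s : Finset κ) (f : κ → X → ℂ) (x : X)
    (h : ∀ i ∈ s, S.RegularAt (f i) x) : S.RegularAt (fun y => ∑ i ∈ s, f i y) x := by
  classical
  induction s using Finset.induction_on with
  | empty => simpa using S.const 0 x
  | insert a s ha ih =>
    simp only [Finset.sum_insert ha]
    exact S.add _ _ x (h a (Finset.mem_insert_self a s))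
      (ih fun i hi => h i (Finset.mem_insert_of_mem hi))

theorem regularAt_prod {κ : Type*} (s : Finset κ) (f : κ → X → ℂ) (x : X)
    (h : ∀ i ∈ s, S.RegularAt (f i) x) : S.RegularAt (fun y => ∏ i ∈ s, f i y) x := by
  classical
  induction s using Finset.induction_on with
  | empty => simpa using S.const 1 x
  | insert a s ha ih =>
    simp only [Finset.prod_insert ha]
    exact S.mul _ _ x (h a (Finset.mem_insert_self a s))
      (ih fun i hi => h i (Finset.mem_insert_of_mem hi))

variable {m k p : Type*} [Fintype k]

theorem regularAt_matrix_mul {A : X → Matrix m k ℂ} {B : X → Matrix k p ℂ} {x : X}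
    (hA : ∀ i j, S.RegularAt (fun y => A y i j) x) (hB : ∀ i j, S.RegularAt (fun y => B y i j) x)
    (i : m) (j : p) : S.RegularAt (fun y => (A y * B y) i j) x := by
  simp only [Matrix.mul_apply]
  exact S.regularAt_sum _ _ x fun l _ => S.mul _ _ x (hA i l) (hB l j)

variable [Fintype m]

theorem regularAt_det [DecidableEq m] {A : X → Matrix m m ℂ} {x : X}
    (hA : ∀ i j, S.RegularAt (fun y => A y i j) x) : S.RegularAt (fun y => (A y).det) x := by
  simp only [Matrix.det_apply']
  exact S.regularAt_sum _ _ x fun σ _ => S.mul _ _ x (S.const _ x)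
    (S.regularAt_prod _ _ x fun i _ => hA _ _)

theorem regularAt_adjugate [DecidableEq m] {A : X → Matrix m m ℂ} {x : X}
    (hA : ∀ i j, S.RegularAt (fun y => A y i j) x) (i j : m) :
    S.RegularAt (fun y => (A y).adjugate i j) x := by
  simp only [Matrix.adjugate_apply]
  refine S.regularAt_det fun a b => ?_
  by_cases h : a = j
  · subst h
    simpa using S.const _ x
  · simpa [Matrix.updateRow_ne h] using hA a b

end General

section Affine

variable {X ι : Type*} (c : X → ι → ℂ)

theorem regularAt_coord (i : ι) (x : X) : (affine c).RegularAt (fun y => c y i) x :=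
  ⟨MvPolynomial.X i, 1, by simp, by simp⟩

theorem affine_isTopologicalBasis : @TopologicalSpace.IsTopologicalBasis X (affine c).top
    {U : Set X | ∃ p : MvPolynomial ι ℂ, U = {x | MvPolynomial.eval (c x) p ≠ 0}} := by
  let : TopologicalSpace X := (affine c).top
  refine ⟨?_, ?_, rfl⟩
  · rintro _ ⟨a, rfl⟩ _ ⟨b, rfl⟩ z ⟨ha, hb⟩
    refine ⟨_, ⟨a * b, rfl⟩, ?_, ?_⟩
    · simpa using ⟨ha, hb⟩
    · intro w hw
      simpa using hw
  · refine Set.eq_univ_of_forall fun z => ⟨_, ⟨1, rfl⟩, by simp⟩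

theorem isOpen_eval_ne_zero (p : MvPolynomial ι ℂ) :
    @IsOpen X (affine c).top {x | MvPolynomial.eval (c x) p ≠ 0} :=
  TopologicalSpace.isOpen_generateFrom_of_mem ⟨p, rfl⟩

variable {c}

theorem RegularAt.eventually_ne_zero {f : X → ℂ} {x : X} (h : (affine c).RegularAt f x)
    (hx : f x ≠ 0) : ∀ᶠ y in @nhds X (affine c).top x, f y ≠ 0 := by
  obtain ⟨p, q, hq, h⟩ := h
  let : TopologicalSpace X := (affine c).top
  have hp : MvPolynomial.eval (c x) p ≠ 0 := by
    intro h0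
    exact hx (by rw [h x hq, h0, zero_div])
  filter_upwards [(isOpen_eval_ne_zero c p).mem_nhds hp,
    (isOpen_eval_ne_zero c q).mem_nhds hq] with y h1 h2
  rw [h y h2]
  exact div_ne_zero h1 h2

theorem RegularAt.inv {f : X → ℂ} {x : X} (h : (affine c).RegularAt f x)
    (hx : f x ≠ 0) : (affine c).RegularAt (fun y => (f y)⁻¹) x := by
  obtain ⟨p, q, hq, h⟩ := h
  have hp : MvPolynomial.eval (c x) p ≠ 0 := by
    intro h0
    exact hx (by rw [h x hq, h0, zero_div])
  refine ⟨q * q, p * q, by simpa using ⟨hp, hq⟩, fun y hy => ?_⟩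
  have hy' : MvPolynomial.eval (c y) p ≠ 0 ∧ MvPolynomial.eval (c y) q ≠ 0 := by simpa using hy
  change (f y)⁻¹ = _
  rw [h y hy'.2, map_mul, map_mul, mul_div_mul_right _ _ hy'.2, inv_div]

theorem regularAt_matrix_inv {m : Type*} [Fintype m] [DecidableEq m] {A : X → Matrix m m ℂ} {x : X}
    (hA : ∀ i j, (affine c).RegularAt (fun y => A y i j) x) (hx : (A x).det ≠ 0) (i j : m) :
    (affine c).RegularAt (fun y => (A y)⁻¹ i j) x := by
  have h : (fun y => (A y)⁻¹ i j) = (fun y => ((A y).det)⁻¹) * fun y => (A y).adjugate i j := by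
    funext y
    simp [Matrix.inv_def, Ring.inverse_eq_inv']
  rw [h]
  exact (affine c).mul _ _ x (((affine c).regularAt_det hA).inv hx)
    ((affine c).regularAt_adjugate hA i j)

theorem regularAt_eval {κ : Type*} {ψ : X → κ → ℂ} {x : X}
    (h : ∀ k, (affine c).RegularAt (fun y => ψ y k) x) (p : MvPolynomial κ ℂ) :
    (affine c).RegularAt (fun y => MvPolynomial.eval (ψ y) p) x := by
  induction p using MvPolynomial.induction_on with
  | C a => simpa using (affine c).const a x
  | add p q hp hq =>
    simp only [map_add]
    exact (affine c).add _ _ x hp hq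
  | mul_X p i hp =>
    simp only [map_mul, MvPolynomial.eval_X]
    exact (affine c).mul _ _ x hp (h i)

theorem isClosed_setOf_eq_zero {f : X → ℂ} (h : ∀ x, (affine c).RegularAt f x) :
    @IsClosed X (affine c).top {x | f x = 0} := by
  let : TopologicalSpace X := (affine c).top
  refine ⟨isOpen_iff_mem_nhds.2 fun x hx => ?_⟩
  exact (h x).eventually_ne_zero hx

theorem isOpen_setOf_ne_zero {f : X → ℂ} {O : Set X} (hO : @IsOpen X (affine c).top O)
    (h : ∀ x ∈ O, (affine c).RegularAt f x) :
    @IsOpen X (affine c).top {x | x ∈ O ∧ f x ≠ 0} := by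
  let : TopologicalSpace X := (affine c).top
  refine isOpen_iff_mem_nhds.2 fun x hx => ?_
  exact Filter.inter_mem (hO.mem_nhds hx.1) ((h x hx.1).eventually_ne_zero hx.2)

section Map

variable {X' ι' : Type*} {c' : X' → ι' → ℂ} {ψ : X → X'} {x : X}

theorem tendsto_of_regularAt (h : ∀ i, (affine c).RegularAt (fun y => c' (ψ y) i) x) :
    Tendsto ψ (@nhds X (affine c).top x) (@nhds X' (affine c').top (ψ x)) := by
  let : TopologicalSpace X := (affine c).top
  let : TopologicalSpace X' := (affine c').top
  rw [(affine_isTopologicalBasis c').nhds_hasBasis.tendsto_right_iff]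
  rintro _ ⟨⟨p, rfl⟩, hp⟩
  exact (regularAt_eval h p).eventually_ne_zero hp

theorem RegularAt.comp_of_regularAt {f : X' → ℂ} (hf : (affine c').RegularAt f (ψ x))
    (h : ∀ i, (affine c).RegularAt (fun y => c' (ψ y) i) x) :
    (affine c).RegularAt (f ∘ ψ) x := by
  obtain ⟨p, q, hq, hf⟩ := hf
  let : TopologicalSpace X := (affine c).top
  refine (affine c).congr _ _ x ?_ ((affine c).mul _ _ x (regularAt_eval h p)
    ((regularAt_eval h q).inv hq))
  filter_upwards [(regularAt_eval h q).eventually_ne_zero hq] with y hy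
  rw [Function.comp_apply, hf _ hy, div_eq_mul_inv]
  rfl

end Map

end Affine

/-! ### Morphisms between subvarieties of quotients -/

section Lift

variable {X ι Y X' ι' Y' : Type*} {c : X → ι → ℂ} {c' : X' → ι' → ℂ} {π : X → Y} {π' : X' → Y'}

/-- A map between subvarieties of quotient varieties is a morphism if locally it is induced by a
regular map defined on a saturated open subset. -/
theorem isMorphism_of_local_lift (hπ : Function.Surjective π) {Z : Set Y} {Z' : Set Y'}
    (ζ : Z → Z')
    (H : ∀ x₀, π x₀ ∈ Z → ∃ (O : Set X) (ψ : X → X'), @IsOpen X (affine c).top O ∧ x₀ ∈ O ∧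
      (∀ x ∈ O, ∀ y, π x = π y → y ∈ O ∧ π' (ψ x) = π' (ψ y)) ∧
      (∀ x ∈ O, ∀ i, (affine c).RegularAt (fun y => c' (ψ y) i) x) ∧
      ∀ x ∈ O, ∀ hx : π x ∈ Z, π' (ψ x) = ζ ⟨π x, hx⟩) :
    (((affine c).quotient π).sub Z).IsMorphism (((affine c').quotient π').sub Z') ζ := by
  let : TopologicalSpace X := (affine c).top
  let : TopologicalSpace X' := (affine c').top
  let : TopologicalSpace Y := ((affine c).quotient π).top
  let : TopologicalSpace Y' := ((affine c').quotient π').top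
  have hcπ : Continuous π := continuous_coinduced_rng
  have hcπ' : Continuous π' := continuous_coinduced_rng
  -- the part of `O` over an open set is saturated and open
  have key : ∀ (O : Set X) (ψ : X → X'), IsOpen O →
      (∀ x ∈ O, ∀ y, π x = π y → y ∈ O ∧ π' (ψ x) = π' (ψ y)) →
      (∀ x ∈ O, ∀ i, (affine c).RegularAt (fun y => c' (ψ y) i) x) →
      ∀ W : Set Y', IsOpen W → IsOpen (π '' {x | x ∈ O ∧ π' (ψ x) ∈ W}) := by
    intro O ψ hO hsat hreg W hW
    have hsat' : π ⁻¹' (π '' {x | x ∈ O ∧ π' (ψ x) ∈ W}) = {x | x ∈ O ∧ π' (ψ x) ∈ W} := by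
      refine Set.Subset.antisymm ?_ (Set.subset_preimage_image _ _)
      rintro y ⟨x, ⟨hx, hxW⟩, hxy⟩
      obtain ⟨h1, h2⟩ := hsat x hx y hxy
      exact ⟨h1, h2 ▸ hxW⟩
    refine isOpen_coinduced.2 ?_
    rw [hsat']
    refine isOpen_iff_mem_nhds.2 fun x hx => Filter.inter_mem (hO.mem_nhds hx.1) ?_
    exact tendsto_of_regularAt (hreg x hx.1) ((hW.preimage hcπ').mem_nhds hx.2)
  have hcont : Continuous ζ := by
    refine continuous_induced_rng.2 (continuous_iff_continuousAt.2 ?_)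
    rintro ⟨z, hz⟩
    obtain ⟨x₀, rfl⟩ := hπ z
    obtain ⟨O, ψ, hO, hx₀, hsat, hreg, hζ⟩ := H x₀ hz
    rw [ContinuousAt, (nhds_basis_opens _).tendsto_right_iff]
    rintro W ⟨hzW, hW⟩
    have hopen := key O ψ hO hsat hreg W hW
    have hmem : π x₀ ∈ π '' {x | x ∈ O ∧ π' (ψ x) ∈ W} := ⟨x₀, ⟨hx₀, by rwa [hζ x₀ hx₀ hz]⟩, rfl⟩
    filter_upwards [continuous_subtype_val.continuousAt.eventually (hopen.mem_nhds hmem)]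
    rintro ⟨_, hy⟩ ⟨x, ⟨hx, hxW⟩, rfl⟩
    rw [hζ x hx hy] at hxW
    exact hxW
  refine ⟨hcont, ?_⟩
  rintro ⟨z, hz⟩ g ⟨G, hG, hgG⟩
  obtain ⟨x₀, rfl⟩ := hπ z
  obtain ⟨O, ψ, hO, hx₀, hsat, hreg, hζ⟩ := H x₀ hz
  obtain ⟨W, hWG, hW, hzW⟩ := mem_nhds_iff.1 hG
  have hopen := key O ψ hO hsat hreg W hW
  have hmem : π x₀ ∈ π '' {x | x ∈ O ∧ π' (ψ x) ∈ W} := ⟨x₀, ⟨hx₀, by rwa [hζ x₀ hx₀ hz]⟩, rfl⟩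
  have hF : ∀ x ∈ O, G (π' (ψ (Function.surjInv hπ (π x)))) = G (π' (ψ x)) := fun x hx => by
    rw [(hsat x hx _ (Function.surjInv_eq hπ _).symm).2]
  refine ⟨fun y => G (π' (ψ (Function.surjInv hπ y))), ?_, ?_⟩
  · change ∀ᶠ y in 𝓝 (π x₀), ∀ x, π x = y → _
    filter_upwards [hopen.mem_nhds hmem]
    rintro _ ⟨x', ⟨hx', hx'W⟩, rfl⟩ x hx
    obtain ⟨hxO, hxe⟩ := hsat x' hx' x hx.symm
    have hGx : (affine c').RegularAt (G ∘ π') (ψ x) := hWG hx'W _ hxe.symm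
    refine (affine c).congr _ _ x ?_ (hGx.comp_of_regularAt (hreg x hxO))
    filter_upwards [hO.mem_nhds hxO] with y hy
    exact (hF y hy).symm
  · filter_upwards [hcont.continuousAt.eventually hgG,
      continuous_subtype_val.continuousAt.eventually (hopen.mem_nhds hmem)]
    rintro ⟨_, hy⟩ h1 ⟨x, ⟨hx, -⟩, rfl⟩
    change g (ζ ⟨π x, hy⟩) = G (π' (ψ (Function.surjInv hπ (π x))))
    rw [hF x hx, hζ x hx hy]
    exact h1

end Lift

end SpaceWithFunctions

/-! ### Coordinate subspaces, adapted bases and normalised frames -/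

/-- The span of the first `k` basis vectors of `ℂ^m`. -/
def coordSub (m k : ℕ) : Submodule ℂ (Fin m → ℂ) where
  carrier := {v | ∀ i, k ≤ i.1 → v i = 0}
  add_mem' := fun ha hb i hi => by rw [Pi.add_apply, ha i hi, hb i hi, add_zero]
  zero_mem' := fun _ _ => rfl
  smul_mem' := fun c v hv i hi => by rw [Pi.smul_apply, hv i hi, smul_zero]

theorem mem_coordSub {m k : ℕ} {v : Fin m → ℂ} :
    v ∈ coordSub m k ↔ ∀ i : Fin m, k ≤ i.1 → v i = 0 := Iff.rfl

theorem coordSub_mono {m k l : ℕ} (h : k ≤ l) : coordSub m k ≤ coordSub m l :=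
  fun _ hv i hi => hv i (h.trans hi)

theorem single_mem_coordSub {m k : ℕ} {i : Fin m} (h : i.1 < k) (a : ℂ) :
    Pi.single i a ∈ coordSub m k := fun j hj => by
  rw [Pi.single_eq_of_ne]
  rintro rfl
  omega

theorem coordSub_le_iff {m k : ℕ} {U : Submodule ℂ (Fin m → ℂ)} :
    coordSub m k ≤ U ↔ ∀ i : Fin m, i.1 < k → Pi.single i 1 ∈ U := by
  refine ⟨fun h i hi => h (single_mem_coordSub hi 1), fun h v hv => ?_⟩
  rw [pi_eq_sum_univ' v]
  refine U.sum_mem fun i _ => ?_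
  by_cases hi : i.1 < k
  · exact U.smul_mem (v i) (h i hi)
  · rw [hv i (by omega), zero_smul]
    exact U.zero_mem

theorem finrank_coordSub {m k : ℕ} (h : k ≤ m) : Module.finrank ℂ (coordSub m k) = k := by
  have hli : LinearIndependent ℂ fun j : Fin k => (Pi.single (Fin.castLE h j) 1 : Fin m → ℂ) := by
    have := (Pi.basisFun ℂ (Fin m)).linearIndependent.comp _ (Fin.castLE_injective h)
    convert this using 1
    ext j
    simp
  have e : coordSub m k =
      Submodule.span ℂ (Set.range fun j : Fin k => (Pi.single (Fin.castLE h j) 1 : Fin m → ℂ)) := by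
    refine le_antisymm (coordSub_le_iff.2 fun i hi => Submodule.subset_span ⟨⟨i, hi⟩, rfl⟩) ?_
    rw [Submodule.span_le]
    rintro _ ⟨j, rfl⟩
    exact single_mem_coordSub (i := Fin.castLE h j) j.2 1
  rw [e, finrank_span_eq_card hli, Fintype.card_fin]

theorem exists_linearIndependent_mem {W : Type*} [AddCommGroup W] [Module ℂ W]
    [FiniteDimensional ℂ W] (T : ℕ → Submodule ℂ W) (m : ℕ)
    (hT : ∀ j < m, j < Module.finrank ℂ (T j)) :
    ∃ v : Fin m → W, LinearIndependent ℂ v ∧ ∀ j : Fin m, v j ∈ T j := by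
  induction m with
  | zero => exact ⟨Fin.elim0, linearIndependent_empty_type, fun j => j.elim0⟩
  | succ m ih =>
    obtain ⟨v, hv, hvT⟩ := ih fun j hj => hT j (by omega)
    obtain ⟨w, hw, hw'⟩ : ∃ w ∈ T m, w ∉ Submodule.span ℂ (Set.range v) := by
      by_contra! h
      have h1 := Submodule.finrank_mono (show T m ≤ Submodule.span ℂ (Set.range v) from h)
      rw [finrank_span_eq_card hv, Fintype.card_fin] at h1
      exact absurd (hT m (by omega)) (by omega)
    refine ⟨Fin.snoc v w, linearIndependent_finSnoc.2 ⟨hv, hw'⟩, fun j => ?_⟩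
    induction j using Fin.lastCases with
    | last => simpa using hw
    | cast j => simpa using hvT j

section Frame

variable {κ ι : Type*} [Fintype κ]

theorem mem_span_range_iff_vecMul {A : Matrix κ ι ℂ} {v : ι → ℂ} :
    v ∈ Submodule.span ℂ (Set.range A.row) ↔ ∃ c : κ → ℂ, Matrix.vecMul c A = v := by
  rw [Submodule.mem_span_range_iff_exists_fun]
  simp only [Matrix.vecMul_eq_sum]
  rfl

theorem exists_eq_mul_of_span_le {κ' : Type*} {A : Matrix κ ι ℂ} {A' : Matrix κ' ι ℂ}
    (h : Submodule.span ℂ (Set.range A'.row) ≤ Submodule.span ℂ (Set.range A.row)) :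
    ∃ p : Matrix κ' κ ℂ, A' = p * A := by
  have h' : ∀ i, ∃ c : κ → ℂ, Matrix.vecMul c A = A' i := fun i =>
    mem_span_range_iff_vecMul.1 (h (Submodule.subset_span ⟨i, rfl⟩))
  choose p hp using h'
  refine ⟨Matrix.of p, ?_⟩
  ext i j
  exact (congrFun (hp i) j).symm

theorem span_mul_le {κ' : Type*} (p : Matrix κ' κ ℂ) (A : Matrix κ ι ℂ) :
    Submodule.span ℂ (Set.range (p * A).row) ≤ Submodule.span ℂ (Set.range A.row) := by
  rw [Submodule.span_le]
  rintro _ ⟨i, rfl⟩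
  exact mem_span_range_iff_vecMul.2 ⟨p i, rfl⟩

variable [DecidableEq κ] [Fintype ι]

/-- The frame with the same row span as `A` whose product with `C` is the identity. -/
noncomputable def normFrame (A : Matrix κ ι ℂ) (C : Matrix ι κ ℂ) : Matrix κ ι ℂ := (A * C)⁻¹ * A

theorem normFrame_of_mul_eq_one {A : Matrix κ ι ℂ} {C : Matrix ι κ ℂ} (h : A * C = 1) :
    normFrame A C = A := by
  rw [normFrame, h, inv_one, Matrix.one_mul]

theorem normFrame_eq_of_span_eq {A A' : Matrix κ ι ℂ} (C : Matrix ι κ ℂ)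
    (h : Submodule.span ℂ (Set.range A.row) = Submodule.span ℂ (Set.range A'.row))
    (hA : (A * C).det ≠ 0) : (A' * C).det ≠ 0 ∧ normFrame A C = normFrame A' C := by
  obtain ⟨p, rfl⟩ := exists_eq_mul_of_span_le h.le
  rw [Matrix.mul_assoc, Matrix.det_mul] at hA
  have hp : IsUnit p.det := isUnit_iff_ne_zero.2 (left_ne_zero_of_mul hA)
  refine ⟨right_ne_zero_of_mul hA, ?_⟩
  rw [normFrame, normFrame, Matrix.mul_assoc, Matrix.mul_inv_rev, ← Matrix.mul_assoc,
    Matrix.mul_assoc _ p⁻¹, Matrix.nonsing_inv_mul _ hp, Matrix.mul_one]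

theorem span_normFrame {A : Matrix κ ι ℂ} {C : Matrix ι κ ℂ} (hA : (A * C).det ≠ 0) :
    Submodule.span ℂ (Set.range (normFrame A C).row) = Submodule.span ℂ (Set.range A.row) := by
  refine le_antisymm (span_mul_le _ _) ?_
  have : A = (A * C) * normFrame A C := by
    rw [normFrame, ← Matrix.mul_assoc, Matrix.mul_nonsing_inv _ (isUnit_iff_ne_zero.2 hA),
      Matrix.one_mul]
  conv_lhs => rw [this]
  exact span_mul_le _ _

theorem exists_mul_eq_one_of_linearIndependent {A : Matrix κ ι ℂ}
    (h : LinearIndependent ℂ A.row) : ∃ C : Matrix ι κ ℂ, A * C = 1 := by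
  classical
  obtain ⟨g, hg⟩ := A.vecMulLinear.exists_leftInverse_of_injective
    (LinearMap.ker_eq_bot.2 (Matrix.vecMul_injective_iff.2 h))
  refine ⟨Matrix.of fun i => g (Pi.single i 1), ?_⟩
  have hC : ∀ v, Matrix.vecMul v (Matrix.of fun i => g (Pi.single i 1)) = g v := fun v => by
    conv_rhs => rw [pi_eq_sum_univ' v]
    rw [map_sum, Matrix.vecMul_eq_sum]
    refine Finset.sum_congr rfl fun i _ => ?_
    rw [map_smul]
    rfl
  ext i j
  have h1 : (A * Matrix.of fun i => g (Pi.single i 1)) i = g (A.row i) := hC _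
  have h2 : g (A.row i) = Pi.single i 1 := by
    have := LinearMap.congr_fun hg (Pi.single i 1)
    simpa using this
  rw [h1, h2, Matrix.one_apply, Pi.single_apply]
  simp [eq_comm]

theorem linearIndependent_of_det_mul_ne_zero {A : Matrix κ ι ℂ} {C : Matrix ι κ ℂ}
    (h : (A * C).det ≠ 0) : LinearIndependent ℂ A.row := by
  refine LinearIndependent.of_comp C.vecMulLinear ?_
  have := Matrix.linearIndependent_rows_iff_isUnit.2
    ((Matrix.isUnit_iff_isUnit_det _).2 (isUnit_iff_ne_zero.2 h))
  exact this

variable {X ι' : Type*} {c : X → ι' → ℂ}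

theorem regularAt_normFrame {A : X → Matrix κ ι ℂ} {C : Matrix ι κ ℂ} {x : X}
    (hA : ∀ i j, (SpaceWithFunctions.affine c).RegularAt (fun y => A y i j) x)
    (h : (A x * C).det ≠ 0) (i : κ) (j : ι) :
    (SpaceWithFunctions.affine c).RegularAt (fun y => normFrame (A y) C i j) x :=
  (SpaceWithFunctions.affine c).regularAt_matrix_mul (SpaceWithFunctions.regularAt_matrix_inv
    (fun i j => (SpaceWithFunctions.affine c).regularAt_matrix_mul (B := fun _ => C) hA
      (fun _ _ => SpaceWithFunctions.const _ _ _) i j) h) hA i j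

end Frame

/-! ### Points of `SL_{2n} / P_λ` as flags -/

section Flag

variable {n s : ℕ}

/-- The span of the first `k` columns of `g`. -/
def flagSub (g : SL n) (k : ℕ) : Submodule ℂ (Fin (2 * n) → ℂ) :=
  (coordSub (2 * n) k).map g.1.mulVecLin

theorem mulVecLin_mul_apply (g h : SL n) (v : Fin (2 * n) → ℂ) :
    (g * h).1.mulVecLin v = g.1.mulVecLin (h.1.mulVecLin v) := by
  rw [Matrix.SpecialLinearGroup.coe_mul, Matrix.mulVecLin_mul]
  rfl

theorem mulVecLin_one_apply (v : Fin (2 * n) → ℂ) :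
    (1 : SL n).1.mulVecLin v = v := by
  rw [Matrix.SpecialLinearGroup.coe_one, Matrix.mulVecLin_one]
  rfl

theorem mulVecLin_injective (g : SL n) : Function.Injective g.1.mulVecLin := by
  apply Function.LeftInverse.injective (g := (g⁻¹).1.mulVecLin)
  intro v
  rw [← mulVecLin_mul_apply, inv_mul_cancel, mulVecLin_one_apply]

theorem mulVecLin_single (g : SL n) (j : Fin (2 * n)) :
    g.1.mulVecLin (Pi.single j 1) = fun i => g.1 i j := by
  rw [Matrix.mulVecLin_apply, Matrix.mulVec_single_one]
  rfl

theorem flagSub_mul (g h : SL n) (k : ℕ) :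
    flagSub (g * h) k = (flagSub h k).map g.1.mulVecLin := by
  rw [flagSub, flagSub, ← Submodule.map_comp]
  congr 1
  exact LinearMap.ext fun v => mulVecLin_mul_apply g h v

theorem finrank_flagSub (g : SL n) {k : ℕ} (hk : k ≤ 2 * n) :
    Module.finrank ℂ (flagSub g k) = k := by
  refine Eq.trans ?_ (finrank_coordSub hk)
  exact (Submodule.equivMapOfInjective _ (mulVecLin_injective g)
    (coordSub (2 * n) k)).finrank_eq.symm

theorem flagSub_mono (g : SL n) {k l : ℕ} (h : k ≤ l) : flagSub g k ≤ flagSub g l :=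
  Submodule.map_mono (coordSub_mono h)

theorem flagSub_le_iff {g : SL n} {k : ℕ} {U : Submodule ℂ (Fin (2 * n) → ℂ)} :
    flagSub g k ≤ U ↔ ∀ j : Fin (2 * n), j.1 < k → (fun i => g.1 i j) ∈ U := by
  rw [flagSub, Submodule.map_le_iff_le_comap, coordSub_le_iff]
  simp only [Submodule.mem_comap, mulVecLin_single]

theorem le_flagSub_iff {g : SL n} {k : ℕ} {U : Submodule ℂ (Fin (2 * n) → ℂ)} :
    U ≤ flagSub g k ↔ U.map (g⁻¹).1.mulVecLin ≤ coordSub (2 * n) k := by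
  constructor
  · rintro h _ ⟨u, hu, rfl⟩
    obtain ⟨v, hv, rfl⟩ := h hu
    rwa [← mulVecLin_mul_apply, inv_mul_cancel, mulVecLin_one_apply]
  · intro h u hu
    refine ⟨_, h ⟨u, hu, rfl⟩, ?_⟩
    rw [← mulVecLin_mul_apply, mul_inv_cancel, mulVecLin_one_apply]

theorem flagSub_eq_iff {g h : SL n} {k : ℕ} (hk : k ≤ 2 * n) :
    flagSub g k = flagSub h k ↔ flagSub (g⁻¹ * h) k ≤ coordSub (2 * n) k := by
  rw [flagSub_mul, ← le_flagSub_iff]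
  refine ⟨fun e => e.ge, fun e => (Submodule.eq_of_le_of_finrank_eq e ?_).symm⟩
  rw [finrank_flagSub _ hk, finrank_flagSub _ hk]

variable (d : Fin s → Set.Icc 1 n)

theorem one_le_d (l : Fin s) : 1 ≤ (d l : ℕ) := (d l).2.1

theorem d_le (l : Fin s) : (d l : ℕ) ≤ n := (d l).2.2

theorem weight_lt_iff (i j : Fin (2 * n)) :
    weight d i < weight d j ↔ ∃ l, j.1 < 2 * (d l : ℕ) - 1 ∧ 2 * (d l : ℕ) - 1 ≤ i.1 := by
  have hw : ∀ i, weight d i = ∑ l, if i.1 + 1 ≤ 2 * (d l : ℕ) - 1 then (1 : ℤ) else 0 := fun i => by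
    simp [weight, fundWeight, Finset.sum_apply]
  rw [hw, hw]
  constructor
  · contrapose!
    intro h
    refine Finset.sum_le_sum fun l _ => ?_
    have := h l
    split_ifs <;> omega
  · rintro ⟨l, hj, hi⟩
    refine Finset.sum_lt_sum (fun m _ => ?_) ⟨l, Finset.mem_univ _, ?_⟩
    · split_ifs <;> omega
    · rw [if_neg (by omega), if_pos (by omega)]
      norm_num

theorem mem_parabolic_iff (g : SL n) :
    g ∈ parabolic (weight d) ↔
      ∀ l, flagSub g (2 * (d l : ℕ) - 1) ≤ coordSub (2 * n) (2 * (d l : ℕ) - 1) := by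
  have h1 : g ∈ parabolic (weight d) ↔ ∀ i j, weight d i < weight d j → g.1 i j = 0 := by
    refine forall_congr' fun i => forall_congr' fun j => ?_
    rw [neg_lt_neg_iff]
  simp only [h1, weight_lt_iff, flagSub_le_iff, mem_coordSub]
  exact ⟨fun h l j hj i hi => h i j ⟨l, hj, hi⟩, fun h i j ⟨l, hj, hi⟩ => h l j hj i hi⟩

theorem mk_eq_mk_iff (g h : SL n) : (g : PartialFlag d) = (h : PartialFlag d) ↔
    ∀ l, flagSub g (2 * (d l : ℕ) - 1) = flagSub h (2 * (d l : ℕ) - 1) := by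
  rw [QuotientGroup.eq, mem_parabolic_iff]
  refine forall_congr' fun l => (flagSub_eq_iff ?_).symm
  have := d_le d l
  omega

/-- The flag of `g` satisfies the incidence conditions with the standard coordinate subspaces that
cut out the Schubert variety of `σ_d`. -/
def IsBounded (g : SL n) : Prop :=
  ∀ l, coordSub (2 * n) ((d l : ℕ) - 1) ≤ flagSub g (2 * (d l : ℕ) - 1) ∧
    flagSub g (2 * (d l : ℕ) - 1) ≤ coordSub (2 * n) (n + d l)

variable {d}

theorem IsBounded.congr {g h : SL n} (hg : IsBounded d g)
    (e : (g : PartialFlag d) = (h : PartialFlag d)) : IsBounded d h := fun l => by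
  rw [← (mk_eq_mk_iff d g h).1 e l]
  exact hg l

variable (d)

theorem isBounded_iff (g : SL n) : IsBounded d g ↔ ∀ (l : Fin s) (i j : Fin (2 * n)),
    (j.1 < (d l : ℕ) - 1 → 2 * (d l : ℕ) - 1 ≤ i.1 → g.1.adjugate i j = 0) ∧
    (j.1 < 2 * (d l : ℕ) - 1 → n + d l ≤ i.1 → g.1 i j = 0) := by
  have h : ∀ l, coordSub (2 * n) ((d l : ℕ) - 1) ≤ flagSub g (2 * (d l : ℕ) - 1) ↔
      flagSub (g⁻¹) ((d l : ℕ) - 1) ≤ coordSub (2 * n) (2 * (d l : ℕ) - 1) := fun l =>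
    le_flagSub_iff
  simp only [IsBounded, h, flagSub_le_iff, mem_coordSub, Matrix.SpecialLinearGroup.coe_inv]
  exact ⟨fun H l i j => ⟨fun hj hi => (H l).1 j hj i hi, fun hj hi => (H l).2 j hj i hi⟩,
    fun H l => ⟨fun j hj i hi => (H l i j).1 hj hi, fun j hj i hi => (H l i j).2 hj hi⟩⟩

theorem isClosed_setOf_isBounded : @IsClosed (SL n) (slVar n).top {g | IsBounded d g} := by
  let : TopologicalSpace (SL n) := (slVar n).top
  have hreg : ∀ (i j : Fin (2 * n)) (g : SL n), (slVar n).RegularAt (fun g => g.1 i j) g :=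
    fun i j g => SpaceWithFunctions.regularAt_coord _ (i, j) g
  simp only [isBounded_iff, Set.ofPred_forall, Set.ofPred_and]
  refine isClosed_iInter fun l => isClosed_iInter fun i => isClosed_iInter fun j =>
    IsClosed.inter (isClosed_iInter fun _ => isClosed_iInter fun _ => ?_)
      (isClosed_iInter fun _ => isClosed_iInter fun _ => ?_)
  · exact SpaceWithFunctions.isClosed_setOf_eq_zero fun g =>
      (slVar n).regularAt_adjugate (fun a b => hreg a b g) i j
  · exact SpaceWithFunctions.isClosed_setOf_eq_zero (hreg i j)

/-- The set of flags satisfying the incidence conditions. -/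
def boundedFlags : Set (PartialFlag d) := {x | ∀ g : SL n, (g : PartialFlag d) = x → IsBounded d g}

variable {d}

theorem mk_mem_boundedFlags {g : SL n} : (g : PartialFlag d) ∈ boundedFlags d ↔ IsBounded d g :=
  ⟨fun h => h g rfl, fun h _ e => h.congr e.symm⟩

variable (d)

theorem isClosed_boundedFlags : @IsClosed _ (partialFlagVar d).top (boundedFlags d) := by
  let : TopologicalSpace (SL n) := (slVar n).top
  have h : (fun g : SL n => (g : PartialFlag d)) ⁻¹' boundedFlags d = {g | IsBounded d g} :=
    Set.ext fun g => mk_mem_boundedFlags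
  refine isClosed_coinduced.2 ?_
  rw [h]
  exact isClosed_setOf_isBounded d

end Flag

section Schubert

variable {n s : ℕ} (d : Fin s → Set.Icc 1 n)

/-! ### The permutation `σ_d` and the Schubert cell -/

theorem weylJ_apply_lt_iff {w : Equiv.Perm (Fin (2 * n))} (hw : w ∈ weylJ d) (l : Fin s) :
    ∀ j, (w j).1 < 2 * (d l : ℕ) - 1 ↔ j.1 < 2 * (d l : ℕ) - 1 := by
  induction hw using Subgroup.closure_induction with
  | mem w hw =>
    obtain ⟨a, b, hab, hne, rfl⟩ := hw
    intro j
    have := hne l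
    rw [Equiv.swap_apply_def]
    split_ifs with h1 h2
    · subst h1
      omega
    · subst h2
      omega
    · rfl
  | one => exact fun j => Iff.rfl
  | mul x y _ _ hx hy => exact fun j => (hx (y j)).trans (hy j)
  | inv x _ hx =>
    intro j
    rw [← hx (x⁻¹ j), Equiv.Perm.coe_inv, Equiv.apply_symm_apply]

theorem exists_sigmaD_eq : ∃ w ∈ weylJ d, sigmaD d = sigma n * w :=
  Function.argminOn_mem permLength (sigmaCoset d) (sigmaCoset_nonempty d)

theorem sigmaD_apply_of_lt {l : Fin s} {j : Fin (2 * n)} (hj : j.1 < 2 * (d l : ℕ) - 1) :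
    (sigmaD d j).1 < (d l : ℕ) - 1 ∨ n ≤ (sigmaD d j).1 ∧ (sigmaD d j).1 < n + d l := by
  obtain ⟨w, hw, e⟩ := exists_sigmaD_eq d
  rw [← weylJ_apply_lt_iff d hw l j] at hj
  have : sigmaD d j = sigmaFun n (w j) := by
    rw [e]
    rfl
  rw [this, sigmaFun]
  split_ifs <;> simp only <;> omega

theorem exists_sigmaD_apply_eq {l : Fin s} {i : Fin (2 * n)} (hi : i.1 < (d l : ℕ) - 1) :
    ∃ j : Fin (2 * n), j.1 < 2 * (d l : ℕ) - 1 ∧ sigmaD d j = i := by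
  obtain ⟨w, hw, e⟩ := exists_sigmaD_eq d
  have hd := d_le d l
  refine ⟨w⁻¹ ⟨2 * i.1 + 1, by omega⟩, ?_, ?_⟩
  · rw [← weylJ_apply_lt_iff d hw l, Equiv.Perm.coe_inv, Equiv.apply_symm_apply]
    change 2 * i.1 + 1 < _
    omega
  · have : sigmaD d (w⁻¹ ⟨2 * i.1 + 1, by omega⟩) = sigmaFun n ⟨2 * i.1 + 1, by omega⟩ := by
      rw [e, Equiv.Perm.mul_apply, Equiv.Perm.coe_inv, Equiv.apply_symm_apply]
      rfl
    rw [this, sigmaFun, if_pos (by simp only; omega)]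
    apply Fin.ext
    simp only
    omega

theorem coordSub_le_flagSub_borel {b : SL n} (hb : b ∈ borel n) (k : ℕ) :
    coordSub (2 * n) k ≤ flagSub b k := by
  rw [le_flagSub_iff]
  change flagSub b⁻¹ k ≤ _
  rw [flagSub_le_iff]
  intro j hj i hi
  exact (borel n).inv_mem hb i j (show j.1 < i.1 by omega)

theorem flagSub_borel {b : SL n} (hb : b ∈ borel n) (k : ℕ) :
    flagSub b k = coordSub (2 * n) k := by
  refine le_antisymm ?_ (coordSub_le_flagSub_borel hb k)
  rw [flagSub_le_iff]
  intro j hj i hi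
  exact hb i j (show j.1 < i.1 by omega)

theorem isBounded_of_monomial {w : SL n} (hw : ∀ i j, w.1 i j ≠ 0 ↔ i = sigmaD d j) :
    IsBounded d w := by
  intro l
  constructor
  · rw [coordSub_le_iff]
    intro i hi
    obtain ⟨j, hj, rfl⟩ := exists_sigmaD_apply_eq d hi
    have h1 : w.1 (sigmaD d j) j ≠ 0 := (hw _ _).2 rfl
    refine ⟨(w.1 (sigmaD d j) j)⁻¹ • Pi.single j 1,
      Submodule.smul_mem _ _ (single_mem_coordSub hj 1), ?_⟩
    rw [map_smul, mulVecLin_single]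
    ext i
    by_cases h : i = sigmaD d j
    · subst h
      simp [h1]
    · have : w.1 i j = 0 := not_not.1 fun h2 => h ((hw i j).1 h2)
      simp [this, h]
  · rw [flagSub_le_iff]
    intro j hj i hi
    have := sigmaD_apply_of_lt d hj
    refine not_not.1 fun h2 => ?_
    rw [(hw i j).1 h2] at hi
    omega

theorem schubertCell_subset : schubertCell d (sigmaD d) ⊆ boundedFlags d := by
  rintro _ ⟨b, hb, w, hw, rfl⟩
  rw [mk_mem_boundedFlags]
  intro l
  obtain ⟨h1, h2⟩ := isBounded_of_monomial d hw l
  rw [flagSub_mul, ← flagSub_borel hb, ← flagSub_borel hb (n + d l)]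
  exact ⟨Submodule.map_mono h1, Submodule.map_mono h2⟩

theorem exists_monomial (τ : Equiv.Perm (Fin (2 * n))) :
    ∃ w : SL n, ∀ i j, w.1 i j ≠ 0 ↔ i = τ j := by
  rcases Nat.eq_zero_or_pos n with rfl | hn
  · exact ⟨1, fun i => i.elim0⟩
  have hs : ((Equiv.Perm.sign τ⁻¹ : ℤ) : ℂ) * ((Equiv.Perm.sign τ⁻¹ : ℤ) : ℂ) = 1 := by
    rw [← Int.cast_mul, Int.units_coe_mul_self, Int.cast_one]
  have hs0 : ((Equiv.Perm.sign τ⁻¹ : ℤ) : ℂ) ≠ 0 := left_ne_zero_of_mul_eq_one hs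
  let D : Fin (2 * n) → ℂ := fun j =>
    if j = ⟨0, by omega⟩ then ((Equiv.Perm.sign τ⁻¹ : ℤ) : ℂ) else 1
  refine ⟨⟨τ⁻¹.permMatrix ℂ * Matrix.diagonal D, ?_⟩, fun i j => ?_⟩
  · rw [Matrix.det_mul, Matrix.det_permutation, Matrix.det_diagonal, Finset.prod_ite_eq' ,
      if_pos (Finset.mem_univ _), hs]
  · have hD : D j ≠ 0 := by
      simp only [D]
      split_ifs
      exacts [hs0, one_ne_zero]
    have h2 : (τ⁻¹.permMatrix ℂ * Matrix.diagonal D) i j = if τ⁻¹ i = j then D j else 0 := by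
      rw [Matrix.mul_diagonal]
      simp [Equiv.Perm.permMatrix, PEquiv.toMatrix_apply]
    change (τ⁻¹.permMatrix ℂ * Matrix.diagonal D) i j ≠ 0 ↔ _
    rw [h2, ← Equiv.Perm.inv_eq_iff_eq]
    split_ifs with h
    · exact ⟨fun _ => h, fun _ => hD⟩
    · exact ⟨fun h' => absurd rfl h', fun h' => absurd h' h⟩

/-- Dimension count characterising generic position with respect to `⟨e_1, ..., e_n⟩`. -/
theorem inf_coordSub_le_iff {k : ℕ} (hk : 1 ≤ k) (hkn : k ≤ n)
    {U : Submodule ℂ (Fin (2 * n) → ℂ)} (hU : Module.finrank ℂ U = 2 * k - 1)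
    (h1 : coordSub (2 * n) (k - 1) ≤ U) (h2 : U ≤ coordSub (2 * n) (n + k)) :
    U ⊓ coordSub (2 * n) n ≤ coordSub (2 * n) (k - 1) ↔
      coordSub (2 * n) (n + k) ≤ U ⊔ coordSub (2 * n) n := by
  have hdim := Submodule.finrank_sup_add_finrank_inf_eq U (coordSub (2 * n) n)
  rw [hU, finrank_coordSub (by omega)] at hdim
  have hinf : coordSub (2 * n) (k - 1) ≤ U ⊓ coordSub (2 * n) n :=
    le_inf h1 (coordSub_mono (by omega))
  have hsup : U ⊔ coordSub (2 * n) n ≤ coordSub (2 * n) (n + k) :=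
    sup_le h2 (coordSub_mono (by omega))
  constructor
  · intro h
    have h3 := Submodule.finrank_mono h
    refine (Submodule.eq_of_le_of_finrank_le hsup ?_).ge
    rw [finrank_coordSub (by omega)] at h3 ⊢
    omega
  · intro h
    have h3 := Submodule.finrank_mono h
    refine (Submodule.eq_of_le_of_finrank_le hinf ?_).ge
    rw [finrank_coordSub (by omega)] at h3 ⊢
    omega

variable {d}

theorem flagSub_monotone (hd : StrictMono d) (g : SL n) {l m : Fin s} (h : l ≤ m) :
    flagSub g (2 * (d l : ℕ) - 1) ≤ flagSub g (2 * (d m : ℕ) - 1) := by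
  have : (d l : ℕ) ≤ d m := hd.monotone h
  exact flagSub_mono g (by omega)

theorem inf_flagSub_le_iff {g : SL n} (hg : IsBounded d g) (l : Fin s) :
    flagSub g (2 * (d l : ℕ) - 1) ⊓ coordSub (2 * n) n ≤ coordSub (2 * n) ((d l : ℕ) - 1) ↔
      coordSub (2 * n) (n + d l) ≤ flagSub g (2 * (d l : ℕ) - 1) ⊔ coordSub (2 * n) n := by
  have := d_le d l
  exact inf_coordSub_le_iff (one_le_d d l) (d_le d l) (finrank_flagSub g (by omega))
    (hg l).1 (hg l).2

theorem mk_mem_schubertCell (hd : StrictMono d) {g : SL n} (hg : IsBounded d g)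
    (h : ∀ l, flagSub g (2 * (d l : ℕ) - 1) ⊓ coordSub (2 * n) n ≤
      coordSub (2 * n) ((d l : ℕ) - 1)) :
    (g : PartialFlag d) ∈ schubertCell d (sigmaD d) := by
  have hv : ∀ j : Fin (2 * n), ∃ e : Fin (2 * n) → ℂ, (∀ i, j ≤ i → e i = 0) ∧
      ∀ l, j.1 < (d l : ℕ) - 1 ∨ n ≤ j.1 ∧ j.1 < n + d l →
        Pi.single j 1 + e ∈ flagSub g (2 * (d l : ℕ) - 1) := by
    intro j
    rcases lt_or_ge j.1 n with hj | hj
    · refine ⟨0, fun _ _ => rfl, fun l hl => ?_⟩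
      rw [add_zero]
      exact (hg l).1 (single_mem_coordSub (by omega) 1)
    · by_cases hl : ∃ l, j.1 < n + d l
      · obtain ⟨l, hl, hmin⟩ := WellFounded.has_min (wellFounded_lt (α := Fin s))
          {l | j.1 < n + d l} hl
        have h1 := (inf_flagSub_le_iff hg l).1 (h l) (single_mem_coordSub hl 1)
        obtain ⟨u, hu, e, he, hue⟩ := Submodule.mem_sup.1 h1
        refine ⟨-e, fun i hi => ?_, fun m hm => ?_⟩
        · rw [Pi.neg_apply, he i (hj.trans hi), neg_zero]
        · have hlm : l ≤ m := not_lt.1 (hmin m (by have := d_le d m; change j.1 < n + d m; omega))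
          rw [← hue, add_neg_cancel_right]
          exact flagSub_monotone hd g hlm hu
      · push Not at hl
        refine ⟨0, fun _ _ => rfl, fun l hl' => ?_⟩
        have := hl l
        have := d_le d l
        omega
  choose e he hmem using hv
  let M : Matrix (Fin (2 * n)) (Fin (2 * n)) ℂ :=
    Matrix.of fun i j => (Pi.single j 1 + e j : Fin (2 * n) → ℂ) i
  have hM : M.BlockTriangular id := by
    intro i j hij
    change j < i at hij
    change (Pi.single j 1 : Fin (2 * n) → ℂ) i + e j i = 0
    rw [he j i hij.le, Pi.single_eq_of_ne hij.ne', add_zero]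
  have hdet : M.det = 1 := by
    rw [Matrix.det_of_isUpperTriangular hM]
    refine Finset.prod_eq_one fun i _ => ?_
    change (Pi.single i 1 : Fin (2 * n) → ℂ) i + e i i = 1
    rw [he i i le_rfl, Pi.single_eq_same, add_zero]
  obtain ⟨w, hw⟩ := exists_monomial (sigmaD d)
  refine ⟨⟨M, hdet⟩, fun i j hij => hM hij, w, hw, ?_⟩
  rw [mk_eq_mk_iff]
  intro l
  have hN : 2 * (d l : ℕ) - 1 ≤ 2 * n := by
    have := d_le d l
    omega
  refine (Submodule.eq_of_le_of_finrank_eq ?_ ?_).symm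
  · rw [flagSub_le_iff]
    intro j hj
    have h1 := (flagSub g (2 * (d l : ℕ) - 1)).smul_mem (w.1 (sigmaD d j) j)
      (hmem (sigmaD d j) l (sigmaD_apply_of_lt d hj))
    convert h1 using 1
    ext i
    change (M * w.1) i j = _
    rw [Matrix.mul_apply, Finset.sum_eq_single (sigmaD d j), mul_comm]
    · rfl
    · intro k _ hk
      rw [not_not.1 fun h2 => hk ((hw k j).1 h2), mul_zero]
    · exact fun h => absurd (Finset.mem_univ _) h
  · rw [finrank_flagSub _ hN, finrank_flagSub _ hN]

/-! ### Density of the cell -/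

/-- A transvection as an element of `SL_{2n}`. -/
noncomputable def slTransvection (f : Module.Dual ℂ (Fin (2 * n) → ℂ)) (b : Fin (2 * n) → ℂ)
    (h : f b = 0) (t : ℂ) : SL n :=
  ⟨LinearMap.toMatrix' (LinearMap.transvection f (t • b)), by
    rw [LinearMap.det_toMatrix', LinearMap.transvection.det, map_smul, h, smul_zero, add_zero]⟩

theorem slTransvection_apply (f : Module.Dual ℂ (Fin (2 * n) → ℂ)) (b : Fin (2 * n) → ℂ)
    (h : f b = 0) (t : ℂ) (v : Fin (2 * n) → ℂ) :
    (slTransvection f b h t).1.mulVecLin v = v + (f v * t) • b := by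
  have : (slTransvection f b h t).1.mulVecLin v = LinearMap.transvection f (t • b) v := by
    rw [← Matrix.toLin'_apply']
    exact LinearMap.congr_fun (Matrix.toLin'_toMatrix' _) v
  rw [this, LinearMap.transvection.apply, mul_smul]

theorem mk_mem_of_forall_slTransvection {Z : Set (PartialFlag d)}
    (hZ : @IsClosed _ (partialFlagVar d).top Z) (f : Module.Dual ℂ (Fin (2 * n) → ℂ))
    (b : Fin (2 * n) → ℂ) (h : f b = 0) (g : SL n)
    (H : ∀ t ≠ 0, ((slTransvection f b h t * g : SL n) : PartialFlag d) ∈ Z) :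
    (g : PartialFlag d) ∈ Z := by
  let : TopologicalSpace (SL n) := (slVar n).top
  let : TopologicalSpace (PartialFlag d) := (partialFlagVar d).top
  by_contra hg
  have hopen : IsOpen ((fun g : SL n => (g : PartialFlag d)) ⁻¹' Zᶜ) :=
    isOpen_coinduced.1 hZ.isOpen_compl
  obtain ⟨_, ⟨p, rfl⟩, hp, hsub⟩ :=
    (SpaceWithFunctions.affine_isTopologicalBasis _).mem_nhds_iff.1 (hopen.mem_nhds hg)
  let F : ℂ → ℂ := fun t => MvPolynomial.eval
    (fun ij : Fin (2 * n) × Fin (2 * n) => (slTransvection f b h t * g).1 ij.1 ij.2) p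
  have hentry : ∀ t (i j : Fin (2 * n)), (slTransvection f b h t * g).1 i j =
      g.1 i j + f (fun i => g.1 i j) * t * b i := by
    intro t i j
    have h1 := congrFun (mulVecLin_single (slTransvection f b h t * g) j) i
    rw [mulVecLin_mul_apply, mulVecLin_single, slTransvection_apply] at h1
    exact h1.symm
  have hF : Continuous F := by
    refine (MvPolynomial.continuous_eval p).comp (continuous_pi fun ij => ?_)
    simp only [hentry]
    fun_prop
  have hF0 : F 0 ≠ 0 := by
    change MvPolynomial.eval (fun ij : Fin (2 * n) × Fin (2 * n) => g.1 ij.1 ij.2) p ≠ 0 at hp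
    simpa only [F, hentry, mul_zero, zero_mul, add_zero] using hp
  have hev : ∀ᶠ t in 𝓝[≠] (0 : ℂ), F t ≠ 0 ∧ t ≠ 0 :=
    (eventually_nhdsWithin_of_eventually_nhds (hF.continuousAt.eventually_ne hF0)).and
      self_mem_nhdsWithin
  obtain ⟨t, ht, ht0⟩ := hev.exists
  exact hsub (a := slTransvection f b h t * g) ht (H t ht0)

end Schubert

section Density

variable {n s : ℕ} {d : Fin s → Set.Icc 1 n}

/-- A flag outside the open cell can be moved into more general position by transvections. -/
theorem exists_slTransvection (hd : StrictMono d) {g : SL n} (hg : IsBounded d g)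
    (hbad : ∃ l, ¬ flagSub g (2 * (d l : ℕ) - 1) ⊓ coordSub (2 * n) n ≤
      coordSub (2 * n) ((d l : ℕ) - 1)) :
    ∃ (f : Module.Dual ℂ (Fin (2 * n) → ℂ)) (b : Fin (2 * n) → ℂ) (h : f b = 0), ∀ t ≠ 0,
      IsBounded d (slTransvection f b h t * g) ∧
      (∀ k, flagSub (slTransvection f b h t * g) (2 * (d k : ℕ) - 1) ⊓ coordSub (2 * n) n ≤
        flagSub g (2 * (d k : ℕ) - 1) ⊓ coordSub (2 * n) n) ∧
      ∃ k, flagSub (slTransvection f b h t * g) (2 * (d k : ℕ) - 1) ⊓ coordSub (2 * n) n <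
        flagSub g (2 * (d k : ℕ) - 1) ⊓ coordSub (2 * n) n := by
  set F : Fin s → Submodule ℂ (Fin (2 * n) → ℂ) := fun l => flagSub g (2 * (d l : ℕ) - 1) with hF
  set E : ℕ → Submodule ℂ (Fin (2 * n) → ℂ) := coordSub (2 * n) with hE
  have hmono : ∀ {l m : Fin s}, l ≤ m → F l ≤ F m := fun h => flagSub_monotone hd g h
  have hdmono : ∀ {l m : Fin s}, l ≤ m → (d l : ℕ) ≤ d m := fun h => hd.monotone h
  have hEm : ∀ {a b : ℕ}, a ≤ b → E a ≤ E b := fun h => coordSub_mono h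
  have hiff : ∀ l, F l ⊓ E n ≤ E ((d l : ℕ) - 1) ↔ E (n + d l) ≤ F l ⊔ E n :=
    inf_flagSub_le_iff hg
  have hdn : ∀ l, (d l : ℕ) ≤ n := d_le d
  obtain ⟨l, hl, hlmin⟩ := WellFounded.has_min (wellFounded_lt (α := Fin s))
    {l | ¬ F l ⊓ E n ≤ E ((d l : ℕ) - 1)} hbad
  have hl' : ¬ E (n + d l) ≤ F l ⊔ E n := fun h => hl ((hiff l).2 h)
  obtain ⟨b₀, hb₀, hb₀l⟩ := SetLike.not_le_iff_exists.1 hl'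
  obtain ⟨m, hm, hmmax⟩ := WellFounded.has_min (wellFounded_gt (α := Fin s))
    {m | b₀ ∉ F m ⊔ E n} ⟨l, hb₀l⟩
  have hlm : l ≤ m := not_lt.1 (hmmax l hb₀l)
  have hm' : b₀ ∉ F m ⊔ E n := hm
  obtain ⟨b, hb, hbF⟩ : ∃ b, b₀ - b ∈ E n ∧ ∀ k, m < k → b ∈ F k := by
    by_cases hk : ∃ k, m < k
    · obtain ⟨k, hk, hkmin⟩ := WellFounded.has_min (wellFounded_lt (α := Fin s)) {k | m < k} hk
      have h1 : b₀ ∈ F k ⊔ E n := by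
        by_contra h
        exact hmmax k h hk
      obtain ⟨y, hy, z, hz, rfl⟩ := Submodule.mem_sup.1 h1
      exact ⟨y, by simpa using hz, fun k' hk' => hmono (not_lt.1 (hkmin k' hk')) hy⟩
    · exact ⟨b₀, by simp, fun k hk' => absurd ⟨k, hk'⟩ hk⟩
  have hbm : ∀ k ≤ m, b ∉ F k ⊔ E n := by
    intro k hk h
    refine hm' ?_
    rw [← sub_add_cancel b₀ b]
    exact add_mem (Submodule.mem_sup_right hb) (sup_le_sup_right (hmono hk) _ h)
  have hbl : b ∈ E (n + d l) := by
    rw [← sub_sub_cancel b₀ b]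
    exact sub_mem hb₀ (hEm (by omega) hb)
  obtain ⟨K, hKm, hK, hKE⟩ : ∃ K ≤ F m, (∀ k, k < l → F k ≤ K) ∧ K ⊓ E n ≤ E ((d m : ℕ) - 1) := by
    by_cases hk : ∃ k, k < l
    · obtain ⟨k, hk, hkmax⟩ := WellFounded.has_min (wellFounded_gt (α := Fin s)) {k | k < l} hk
      refine ⟨F k, hmono (le_trans (le_of_lt hk) hlm),
        fun k' hk' => hmono (not_lt.1 (hkmax k' hk')), ?_⟩
      have h1 : F k ⊓ E n ≤ E ((d k : ℕ) - 1) := by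
        by_contra h
        exact hlmin k h hk
      have : (d k : ℕ) ≤ d m := hdmono (le_trans (le_of_lt hk) hlm)
      exact h1.trans (hEm (by omega))
    · exact ⟨⊥, bot_le, fun k hk' => absurd ⟨k, hk'⟩ hk, by simp⟩
  have hmbad : ¬ F m ⊓ E n ≤ E ((d m : ℕ) - 1) := fun h =>
    hm' ((hiff m).1 h (hEm (by have := hdmono hlm; omega) hb₀))
  obtain ⟨a, ⟨ham, haE⟩, ha⟩ := SetLike.not_le_iff_exists.1 hmbad
  have haS : a ∉ E ((d m : ℕ) - 1) ⊔ K ⊔ Submodule.span ℂ {b} := by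
    intro h
    obtain ⟨_, h1, _, h2, rfl⟩ := Submodule.mem_sup.1 h
    obtain ⟨e, he, u, hu, rfl⟩ := Submodule.mem_sup.1 h1
    obtain ⟨c, rfl⟩ := Submodule.mem_span_singleton.1 h2
    have heE : e ∈ E n := hEm (by have := hdn m; omega) he
    have hc : c = 0 := by
      by_contra hc
      refine hbm m le_rfl ?_
      have h3 : c • b ∈ F m ⊔ E n := by
        have : c • b = (e + u + c • b) - u - e := by abel
        rw [this]
        exact sub_mem (Submodule.mem_sup_left (sub_mem ham (hKm hu))) (Submodule.mem_sup_right heE)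
      exact (Submodule.smul_mem_iff _ hc).1 h3
    subst hc
    rw [zero_smul, add_zero] at haE ha
    refine ha (add_mem he (hKE ⟨hu, ?_⟩))
    have := sub_mem haE heE
    rwa [add_sub_cancel_left] at this
  obtain ⟨f, hfa, hf⟩ := Submodule.exists_le_ker_of_notMem haS
  have hfE : ∀ v ∈ E ((d m : ℕ) - 1), f v = 0 := fun v hv =>
    hf (Submodule.mem_sup_left (Submodule.mem_sup_left hv))
  have hfK : ∀ v ∈ K, f v = 0 := fun v hv =>
    hf (Submodule.mem_sup_left (Submodule.mem_sup_right hv))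
  have hfb : f b = 0 := hf (Submodule.mem_sup_right (Submodule.mem_span_singleton_self b))
  refine ⟨f, b, hfb, fun t ht => ?_⟩
  set g' := slTransvection f b hfb t with hg'
  have hT : ∀ v, g'.1.mulVecLin v = v + (f v * t) • b := slTransvection_apply f b hfb t
  have hF' : ∀ k, flagSub (g' * g) (2 * (d k : ℕ) - 1) = (F k).map g'.1.mulVecLin :=
    fun k => flagSub_mul g' g _
  have hlow : ∀ k, k < l → (F k).map g'.1.mulVecLin ≤ F k := by
    rintro k hk _ ⟨v, hv, rfl⟩
    rw [hT, hfK v (hK k hk hv), zero_mul, zero_smul, add_zero]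
    exact hv
  have hhigh' : ∀ k, m < k → (F k).map g'.1.mulVecLin ≤ F k := by
    rintro k hk _ ⟨v, hv, rfl⟩
    rw [hT]
    exact add_mem hv (Submodule.smul_mem _ _ (hbF k hk))
  have hhigh : ∀ k, m < k → (F k).map g'.1.mulVecLin = F k := by
    intro k hk
    refine Submodule.eq_of_le_of_finrank_eq (hhigh' k hk) ?_
    exact (Submodule.equivMapOfInjective _ (mulVecLin_injective g') (F k)).finrank_eq.symm
  have hker : ∀ k ≤ m, ∀ v ∈ F k, g'.1.mulVecLin v ∈ E n → f v = 0 := by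
    intro k hk v hv hvE
    by_contra hfv
    refine hbm k hk ?_
    rw [hT] at hvE
    have h3 : (f v * t) • b ∈ F k ⊔ E n := by
      rw [← add_sub_cancel_left v ((f v * t) • b)]
      exact sub_mem (Submodule.mem_sup_right hvE) (Submodule.mem_sup_left hv)
    exact (Submodule.smul_mem_iff _ (mul_ne_zero hfv ht)).1 h3
  have hinf : ∀ k, (F k).map g'.1.mulVecLin ⊓ E n ≤ F k ⊓ E n := by
    intro k
    rcases le_or_gt k m with hk | hk
    · rintro _ ⟨⟨v, hv, rfl⟩, hvE⟩
      refine ⟨?_, hvE⟩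
      have h1 := hker k hk v hv hvE
      change g'.1.mulVecLin v ∈ F k
      rw [hT, h1, zero_mul, zero_smul, add_zero]
      exact hv
    · rw [hhigh k hk]
  simp only [hF']
  refine ⟨fun k => ?_, hinf, m, lt_of_le_of_ne (hinf m) fun h => ?_⟩
  · rw [hF']
    rcases le_or_gt k m with hk | hk
    · constructor
      · intro v hv
        have := hdmono hk
        have h1 := hfE v (hEm (by omega) hv)
        refine ⟨v, (hg k).1 hv, ?_⟩
        rw [hT, h1, zero_mul, zero_smul, add_zero]
      · rcases lt_or_ge k l with hkl | hkl
        · exact (hlow k hkl).trans (hg k).2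
        · rintro _ ⟨v, hv, rfl⟩
          rw [hT]
          have := hdmono hkl
          exact add_mem ((hg k).2 hv) (Submodule.smul_mem _ _ (hEm (by omega) hbl))
    · rw [hhigh k hk]
      exact hg k
  · have ha' : a ∈ (F m).map g'.1.mulVecLin ⊓ E n := h ▸ ⟨ham, haE⟩
    obtain ⟨⟨v, hv, rfl⟩, hvE⟩ := ha'
    have h1 := hker m le_rfl v hv hvE
    rw [hT, h1, zero_mul, zero_smul, add_zero] at hfa
    exact hfa h1

theorem boundedFlags_subset_schubert (hd : StrictMono d) :
    boundedFlags d ⊆ schubert d (sigmaD d) := by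
  let : TopologicalSpace (PartialFlag d) := (partialFlagVar d).top
  have key : ∀ (N : ℕ) (g : SL n), IsBounded d g →
      ∑ k, Module.finrank ℂ
        (flagSub g (2 * (d k : ℕ) - 1) ⊓ coordSub (2 * n) n : Submodule ℂ _) = N →
      (g : PartialFlag d) ∈ schubert d (sigmaD d) := by
    intro N
    induction N using Nat.strong_induction_on with
    | _ N ih =>
      intro g hg hN
      by_cases hbad : ∃ l, ¬ flagSub g (2 * (d l : ℕ) - 1) ⊓ coordSub (2 * n) n ≤
          coordSub (2 * n) ((d l : ℕ) - 1)
      · obtain ⟨f, b, h, H⟩ := exists_slTransvection hd hg hbad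
        refine mk_mem_of_forall_slTransvection (Z := schubert d (sigmaD d)) isClosed_closure
          f b h g fun t ht => ?_
        obtain ⟨h1, h2, k, hk⟩ := H t ht
        refine ih _ ?_ _ h1 rfl
        rw [← hN]
        exact Finset.sum_lt_sum (fun k _ => Submodule.finrank_mono (h2 k))
          ⟨k, Finset.mem_univ _, Submodule.finrank_lt_finrank_of_lt hk⟩
      · push Not at hbad
        exact subset_closure (mk_mem_schubertCell hd hg hbad)
  intro x hx
  obtain ⟨g, rfl⟩ := QuotientGroup.mk_surjective x
  exact key _ g (mk_mem_boundedFlags.1 hx) rfl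

/-- The Schubert variety of `σ_d` is cut out by incidence conditions. -/
theorem schubert_eq_boundedFlags (hd : StrictMono d) :
    schubert d (sigmaD d) = boundedFlags d := by
  let : TopologicalSpace (PartialFlag d) := (partialFlagVar d).top
  refine Set.Subset.antisymm ?_ (boundedFlags_subset_schubert hd)
  exact closure_minimal (schubertCell_subset d) (isClosed_boundedFlags d)

theorem mk_mem_schubert_iff (hd : StrictMono d) (g : SL n) :
    (g : PartialFlag d) ∈ schubert d (sigmaD d) ↔ IsBounded d g := by
  rw [schubert_eq_boundedFlags hd, mk_mem_boundedFlags]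

end Density

/-! ### Subspaces of `V` and subspaces of `ℂ^{2n}` -/

section Window

variable {n : ℕ} (i : Set.Icc 1 n)

/-- The projection `ℂ^{2n} → V` onto the coordinates occurring in the `i`-th copy of `V`. -/
def window : (Fin (2 * n) → ℂ) →ₗ[ℂ] V n := LinearMap.funLeft ℂ ℂ (scaleIndex i)

theorem window_apply (v : Fin (2 * n) → ℂ) (k : Fin (n + 1)) :
    window i v k = v (scaleIndex i k) := rfl

theorem scaleIndex_val (k : Fin (n + 1)) :
    (scaleIndex i k).1 = if (i : ℕ) ≤ k.1 + 1 then k.1 else n + 1 + k.1 := by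
  unfold scaleIndex
  split_ifs <;> rfl

theorem scaleIndex_injective : Function.Injective (scaleIndex i) := by
  intro k l h
  have h1 := congrArg Fin.val h
  rw [scaleIndex_val, scaleIndex_val] at h1
  have hk := k.2
  have hl := l.2
  apply Fin.ext
  split_ifs at h1 <;> omega

theorem scaleIndex_bounds (k : Fin (n + 1)) :
    (i : ℕ) - 1 ≤ (scaleIndex i k).1 ∧ (scaleIndex i k).1 < n + i := by
  have h1 : 1 ≤ (i : ℕ) := i.2.1
  have h2 : (i : ℕ) ≤ n := i.2.2
  rw [scaleIndex_val]
  split_ifs <;> omega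

theorem exists_scaleIndex_eq {r : Fin (2 * n)} (h1 : (i : ℕ) - 1 ≤ r.1) (h2 : r.1 < n + i) :
    ∃ k, scaleIndex i k = r := by
  have h3 : 1 ≤ (i : ℕ) := i.2.1
  have h4 : (i : ℕ) ≤ n := i.2.2
  rcases Nat.lt_or_ge n r.1 with h | h
  · refine ⟨⟨r.1 - (n + 1), by omega⟩, Fin.ext ?_⟩
    rw [scaleIndex_val, if_neg (by simp only; omega)]
    simp only
    omega
  · refine ⟨⟨r.1, by omega⟩, Fin.ext ?_⟩
    rw [scaleIndex_val, if_pos (by simp only; omega)]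

theorem window_eq_zero {v : Fin (2 * n) → ℂ} (hv : v ∈ coordSub (2 * n) ((i : ℕ) - 1)) :
    window i v = 0 :=
  funext fun k => hv _ (scaleIndex_bounds i k).1

theorem mem_coordSub_of_window_eq_zero {v : Fin (2 * n) → ℂ}
    (hv : v ∈ coordSub (2 * n) (n + i)) (h : window i v = 0) :
    v ∈ coordSub (2 * n) ((i : ℕ) - 1) := by
  intro r hr
  rcases lt_or_ge r.1 (n + i) with h1 | h1
  · obtain ⟨k, rfl⟩ := exists_scaleIndex_eq i hr h1
    exact congrFun h k
  · exact hv r h1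

/-- The section of `window i` that inserts zeros. -/
noncomputable def unwindow : V n →ₗ[ℂ] (Fin (2 * n) → ℂ) :=
  Function.ExtendByZero.linearMap ℂ (scaleIndex i)

theorem window_unwindow (v : V n) : window i (unwindow i v) = v :=
  funext fun k => (scaleIndex_injective i).extend_apply v 0 k

theorem unwindow_mem (v : V n) : unwindow i v ∈ coordSub (2 * n) (n + i) := by
  intro r hr
  refine Function.extend_apply' v (0 : Fin (2 * n) → ℂ) r ?_
  rintro ⟨k, rfl⟩
  have := (scaleIndex_bounds i k).2
  omega

theorem unwindow_injective : Function.Injective (unwindow i) :=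
  Function.LeftInverse.injective (window_unwindow i)

/-- The preimage of a subspace of `V` in `⟨e_1, ..., e_{n+i}⟩`. -/
def windowComap (U : Submodule ℂ (V n)) : Submodule ℂ (Fin (2 * n) → ℂ) :=
  U.comap (window i) ⊓ coordSub (2 * n) (n + i)

theorem coordSub_le_windowComap (U : Submodule ℂ (V n)) :
    coordSub (2 * n) ((i : ℕ) - 1) ≤ windowComap i U := fun v hv =>
  ⟨by rw [SetLike.mem_coe, Submodule.mem_comap, window_eq_zero i hv]; exact U.zero_mem,
    coordSub_mono (by omega) hv⟩

theorem map_windowComap (U : Submodule ℂ (V n)) : (windowComap i U).map (window i) = U := by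
  refine le_antisymm ?_ fun v hv => ?_
  · rintro _ ⟨v, hv, rfl⟩
    exact hv.1
  · refine ⟨unwindow i v, ⟨?_, unwindow_mem i v⟩, window_unwindow i v⟩
    rw [SetLike.mem_coe, Submodule.mem_comap, window_unwindow]
    exact hv

theorem windowComap_map {U : Submodule ℂ (Fin (2 * n) → ℂ)}
    (h1 : coordSub (2 * n) ((i : ℕ) - 1) ≤ U) (h2 : U ≤ coordSub (2 * n) (n + i)) :
    windowComap i (U.map (window i)) = U := by
  refine le_antisymm ?_ fun v hv => ⟨⟨v, hv, rfl⟩, h2 hv⟩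
  rintro v ⟨⟨u, hu, huv⟩, hv⟩
  have h3 : v - u ∈ coordSub (2 * n) ((i : ℕ) - 1) := by
    refine mem_coordSub_of_window_eq_zero i (sub_mem hv (h2 hu)) ?_
    rw [map_sub, huv, sub_self]
  rw [← sub_add_cancel v u]
  exact add_mem (h1 h3) hu

theorem finrank_windowComap (U : Submodule ℂ (V n)) :
    Module.finrank ℂ (windowComap i U) = ((i : ℕ) - 1) + Module.finrank ℂ U := by
  have h2 : (i : ℕ) ≤ n := i.2.2
  have hsup : windowComap i U = coordSub (2 * n) ((i : ℕ) - 1) ⊔ U.map (unwindow i) := by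
    refine le_antisymm ?_ (sup_le (coordSub_le_windowComap i U) ?_)
    · rintro v ⟨hv, hv'⟩
      rw [← sub_add_cancel v (unwindow i (window i v))]
      refine add_mem (Submodule.mem_sup_left (mem_coordSub_of_window_eq_zero i
        (sub_mem hv' (unwindow_mem i _)) ?_)) (Submodule.mem_sup_right ⟨_, hv, rfl⟩)
      rw [map_sub, window_unwindow, sub_self]
    · rintro _ ⟨v, hv, rfl⟩
      refine ⟨?_, unwindow_mem i v⟩
      rw [SetLike.mem_coe, Submodule.mem_comap, window_unwindow]
      exact hv
  have hinf : coordSub (2 * n) ((i : ℕ) - 1) ⊓ U.map (unwindow i) = ⊥ := by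
    rw [eq_bot_iff]
    rintro _ ⟨h, v, hv, rfl⟩
    have := window_eq_zero i h
    rw [window_unwindow] at this
    rw [this, map_zero]
    exact Submodule.zero_mem _
  have hdim := Submodule.finrank_sup_add_finrank_inf_eq (coordSub (2 * n) ((i : ℕ) - 1))
    (U.map (unwindow i))
  rw [← hsup, hinf, finrank_bot, add_zero, finrank_coordSub (by omega)] at hdim
  rw [hdim, (Submodule.equivMapOfInjective _ (unwindow_injective i) U).finrank_eq]

theorem prSeg_window {j : Set.Icc 1 n} (hij : i ≤ j) {v : Fin (2 * n) → ℂ}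
    (hv : v ∈ coordSub (2 * n) (n + i)) : prSeg n i j (window i v) = window j v := by
  have hij' : (i : ℕ) ≤ j := hij
  funext k
  change prComp n i (j - i) (window i v) k = _
  rw [prComp_apply, window_apply, window_apply]
  have hi := scaleIndex_val i k
  have hj := scaleIndex_val j k
  split_ifs with h
  · refine (hv _ ?_).symm
    rw [hj, if_neg (by omega)]
    omega
  · congr 1
    apply Fin.ext
    rw [hi, hj]
    split_ifs <;> omega

theorem window_torus (t : torus n) (v : Fin (2 * n) → ℂ) :
    window i (t.1.1.mulVecLin v) = torusRep i t (window i v) := by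
  funext k
  change ∑ j, t.1.1 (scaleIndex i k) j * v j = t.1.1 (scaleIndex i k) (scaleIndex i k) * _
  rw [Finset.sum_eq_single (scaleIndex i k)]
  · rfl
  · intro j _ hj
    rw [t.2 _ _ hj.symm, zero_mul]
  · exact fun h => absurd (Finset.mem_univ _) h

end Window

/-! ### Elements of `SL_{2n}` with prescribed flag -/

section Columns

variable {n s : ℕ}

/-- The scaling of the last column that normalises the determinant. -/
noncomputable def detScale (M : Matrix (Fin (2 * n)) (Fin (2 * n)) ℂ) (j : Fin (2 * n)) : ℂ :=
  if j.1 + 1 = 2 * n then M.det⁻¹ else 1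

theorem det_mul_prod_detScale {M : Matrix (Fin (2 * n)) (Fin (2 * n)) ℂ} (hM : M.det ≠ 0) :
    (M * Matrix.diagonal (detScale M)).det = 1 := by
  rw [Matrix.det_mul, Matrix.det_diagonal]
  rcases Nat.eq_zero_or_pos n with rfl | hn
  · simp [Matrix.det_fin_zero]
  · rw [Finset.prod_eq_single (⟨2 * n - 1, by omega⟩ : Fin (2 * n)), detScale,
      if_pos (by simp only; omega), mul_inv_cancel₀ hM]
    · intro j _ hj
      rw [detScale, if_neg]
      exact fun h => hj (Fin.ext (by simp only; omega))
    · exact fun h => absurd (Finset.mem_univ _) h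

/-- The matrix in `SL_{2n}` obtained by scaling the last column of an invertible matrix. -/
noncomputable def slOfMatrix (M : Matrix (Fin (2 * n)) (Fin (2 * n)) ℂ) (hM : M.det ≠ 0) : SL n :=
  ⟨M * Matrix.diagonal (detScale M), det_mul_prod_detScale hM⟩

theorem slOfMatrix_apply {M : Matrix (Fin (2 * n)) (Fin (2 * n)) ℂ} (hM : M.det ≠ 0)
    (i j : Fin (2 * n)) : (slOfMatrix M hM).1 i j = M i j * detScale M j :=
  Matrix.mul_diagonal _ _ _ _

theorem flagSub_slOfMatrix_eq {M : Matrix (Fin (2 * n)) (Fin (2 * n)) ℂ} (hM : M.det ≠ 0)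
    {k : ℕ} (hk : k ≤ 2 * n) {U : Submodule ℂ (Fin (2 * n) → ℂ)} (hU : Module.finrank ℂ U = k)
    (h : ∀ j : Fin (2 * n), j.1 < k → (fun i => M i j) ∈ U) : flagSub (slOfMatrix M hM) k = U := by
  refine Submodule.eq_of_le_of_finrank_eq ?_ (by rw [finrank_flagSub _ hk, hU])
  rw [flagSub_le_iff]
  intro j hj
  convert U.smul_mem (detScale M j) (h j hj) using 1
  funext i
  rw [slOfMatrix_apply, mul_comm]
  rfl

theorem exists_flagSub_eq (N : Fin s → ℕ) (hN : ∀ l, N l ≤ 2 * n)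
    (B : Fin s → Submodule ℂ (Fin (2 * n) → ℂ)) (hB : Monotone B)
    (hBN : ∀ l, Module.finrank ℂ (B l) = N l) : ∃ g : SL n, ∀ l, flagSub g (N l) = B l := by
  obtain ⟨v, hv, hvT⟩ := exists_linearIndependent_mem
    (fun j => ⨅ (l : Fin s) (_ : j < N l), B l) (2 * n) fun j hj => by
      by_cases h : ∃ l, j < N l
      · obtain ⟨l, hl, hmin⟩ := WellFounded.has_min (wellFounded_lt (α := Fin s)) {l | j < N l} h
        have hle : B l ≤ ⨅ (l : Fin s) (_ : j < N l), B l :=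
          le_iInf₂ fun m hm => hB (not_lt.1 (hmin m hm))
        have := Submodule.finrank_mono hle
        rw [hBN] at this
        exact lt_of_lt_of_le hl this
      · have htop : (⨅ (l : Fin s) (_ : j < N l), B l) = ⊤ := by
          push Not at h
          simp only [iInf_eq_top]
          exact fun l hl => absurd hl (not_lt.2 (h l))
        rw [htop, finrank_top]
        simpa using hj
  let M : Matrix (Fin (2 * n)) (Fin (2 * n)) ℂ := Matrix.of fun i j => v j i
  have hM : M.det ≠ 0 := by
    have h1 : IsUnit M := Matrix.linearIndependent_cols_iff_isUnit.1 hv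
    exact isUnit_iff_ne_zero.1 ((Matrix.isUnit_iff_isUnit_det _).1 h1)
  refine ⟨slOfMatrix M hM, fun l => flagSub_slOfMatrix_eq hM (hN l) (hBN l) fun j hj => ?_⟩
  have := hvT j
  simp only [Submodule.mem_iInf] at this
  exact this l hj

end Columns

/-! ### The bijection -/

section Bijection

variable {n s : ℕ} {d : Fin s → Set.Icc 1 n}

theorem flagDim_le (d : Fin s → Set.Icc 1 n) (l : Fin s) : 2 * (d l : ℕ) - 1 ≤ 2 * n := by
  have := d_le d l
  omega

theorem windowComap_flagSub {g : SL n} (hg : IsBounded d g) (l : Fin s) :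
    windowComap (d l) ((flagSub g (2 * (d l : ℕ) - 1)).map (window (d l))) =
      flagSub g (2 * (d l : ℕ) - 1) :=
  windowComap_map (d l) (hg l).1 (hg l).2

theorem finrank_map_window_flagSub {g : SL n} (hg : IsBounded d g) (l : Fin s) :
    Module.finrank ℂ ((flagSub g (2 * (d l : ℕ) - 1)).map (window (d l))) = d l := by
  have h1 := finrank_windowComap (d l) ((flagSub g (2 * (d l : ℕ) - 1)).map (window (d l)))
  rw [windowComap_flagSub hg, finrank_flagSub g (flagDim_le d l)] at h1
  have := one_le_d d l
  omega

theorem map_window_mem_degFlag (hd : StrictMono d) {g : SL n} (hg : IsBounded d g) :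
    (fun l => ⟨(flagSub g (2 * (d l : ℕ) - 1)).map (window (d l)),
      finrank_map_window_flagSub hg l⟩ : GrProd d) ∈ degFlag d := by
  intro l m hlm
  have hle : l ≤ m := by
    rw [Fin.le_def]
    omega
  rintro _ ⟨_, ⟨v, hv, rfl⟩, rfl⟩
  refine ⟨v, flagSub_monotone hd g hle hv, ?_⟩
  exact (prSeg_window (d l) (hd.monotone hle) ((hg l).2 hv)).symm

theorem windowComap_monotone (hd : StrictMono d) {U : GrProd d} (hU : U ∈ degFlag d) :
    Monotone fun l => windowComap (d l) (U l).1 := by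
  have key : ∀ (k : ℕ) (l m : Fin s), m.1 = l.1 + k →
      windowComap (d l) (U l).1 ≤ windowComap (d m) (U m).1 := by
    intro k
    induction k with
    | zero =>
      intro l m h
      obtain rfl : m = l := Fin.ext h
      exact le_rfl
    | succ k ih =>
      intro l m h
      have hm := m.2
      refine (ih l ⟨l.1 + k, by omega⟩ rfl).trans ?_
      set l' : Fin s := ⟨l.1 + k, by omega⟩
      have hl' : m.1 = l'.1 + 1 := h
      have hle : d l' ≤ d m := hd.monotone (by rw [Fin.le_def]; omega)
      rintro v ⟨hv, hv'⟩
      refine ⟨?_, coordSub_mono (Nat.add_le_add_left hle n) hv'⟩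
      rw [SetLike.mem_coe, Submodule.mem_comap, ← prSeg_window (d l') hle hv']
      exact hU l' m hl' ⟨_, hv, rfl⟩
  intro l m h
  exact key (m.1 - l.1) l m (by rw [Fin.le_def] at h; omega)

/-- The map from the Schubert variety to the partial degenerate flag variety. -/
noncomputable def toDegFlag (hd : StrictMono d) (x : schubert d (sigmaD d)) : degFlag d :=
  ⟨_, map_window_mem_degFlag hd (g := x.1.out)
    ((mk_mem_schubert_iff hd _).1 (by rw [QuotientGroup.out_eq']; exact x.2))⟩

theorem toDegFlag_mk (hd : StrictMono d) (g : SL n)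
    (hg : (g : PartialFlag d) ∈ schubert d (sigmaD d)) (l : Fin s) :
    ((toDegFlag hd ⟨g, hg⟩).1 l).1 = (flagSub g (2 * (d l : ℕ) - 1)).map (window (d l)) := by
  change (flagSub (g : PartialFlag d).out _).map _ = _
  rw [(mk_eq_mk_iff d (g : PartialFlag d).out g).1 (QuotientGroup.out_eq' _) l]

theorem toDegFlag_bijective (hd : StrictMono d) : Function.Bijective (toDegFlag hd) := by
  constructor
  · rintro ⟨x, hx⟩ ⟨y, hy⟩ h
    obtain ⟨g, rfl⟩ := QuotientGroup.mk_surjective x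
    obtain ⟨g', rfl⟩ := QuotientGroup.mk_surjective y
    rw [Subtype.mk_eq_mk, mk_eq_mk_iff]
    intro l
    have h1 := congrArg (fun U : degFlag d => (U.1 l).1) h
    simp only [toDegFlag_mk] at h1
    rw [← windowComap_flagSub ((mk_mem_schubert_iff hd _).1 hx) l, h1,
      windowComap_flagSub ((mk_mem_schubert_iff hd _).1 hy) l]
  · rintro ⟨U, hU⟩
    obtain ⟨g, hg⟩ := exists_flagSub_eq (fun l => 2 * (d l : ℕ) - 1) (flagDim_le d)
      (fun l => windowComap (d l) (U l).1) (windowComap_monotone hd hU) fun l => by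
        have := one_le_d d l
        rw [finrank_windowComap, (U l).2]
        omega
    have hb : IsBounded d g := fun l => by
      rw [hg l]
      exact ⟨coordSub_le_windowComap _ _, inf_le_right⟩
    refine ⟨⟨g, (mk_mem_schubert_iff hd g).2 hb⟩, Subtype.ext (funext fun l => Subtype.ext ?_)⟩
    rw [toDegFlag_mk, hg l, map_windowComap]

theorem toDegFlag_actSchubert (hd : StrictMono d) (t : torus n) (x : schubert d (sigmaD d)) :
    toDegFlag hd (actSchubert d (sigmaD d) t x) = actDegFlag d hd t (toDegFlag hd x) := by
  obtain ⟨x, hx⟩ := x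
  obtain ⟨g, rfl⟩ := QuotientGroup.mk_surjective x
  refine Subtype.ext (funext fun l => Subtype.ext ?_)
  have h1 := toDegFlag_mk hd g hx l
  have h2 := toDegFlag_mk hd (t.1 * g) (smul_mem_schubert d _ t _ hx) l
  refine h2.trans (Eq.trans ?_ (congrArg (Submodule.map (torusRep (d l) t)) h1).symm)
  rw [flagSub_mul, ← Submodule.map_comp, ← Submodule.map_comp]
  congr 1
  exact LinearMap.ext fun v => window_torus (d l) t v

end Bijection

section Morphisms

variable {n s : ℕ} {d : Fin s → Set.Icc 1 n}

theorem exists_linearIndependent_span_eq {W : Type*} [AddCommGroup W] [Module ℂ W]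
    [FiniteDimensional ℂ W] {U : Submodule ℂ W} {k : ℕ} (hU : Module.finrank ℂ U = k) :
    ∃ A : Fin k → W, LinearIndependent ℂ A ∧ Submodule.span ℂ (Set.range A) = U := by
  let b := Module.finBasisOfFinrankEq ℂ U hU
  refine ⟨fun i => (b i : W), b.linearIndependent.map' U.subtype U.ker_subtype, ?_⟩
  have h : Set.range (fun i => (b i : W)) = U.subtype '' Set.range b := by
    rw [← Set.range_comp]
    rfl
  rw [h, Submodule.span_image, b.span_eq, Submodule.map_top, Submodule.range_subtype]

theorem spanMap_surjective (d : Fin s → Set.Icc 1 n) : Function.Surjective (spanMap d) := by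
  intro U
  choose A hA hAU using fun l => exists_linearIndependent_span_eq (U l).2
  exact ⟨fun l => ⟨A l, hA l⟩, funext fun l => Subtype.ext (hAU l)⟩

/-! ### From the Schubert variety to the degenerate flag variety -/

/-- The first `k` columns of `g`, as the rows of a matrix. -/
def colFrame (g : SL n) {k : ℕ} (hk : k ≤ 2 * n) : Matrix (Fin k) (Fin (2 * n)) ℂ :=
  Matrix.of fun j i => g.1 i (Fin.castLE hk j)

theorem span_colFrame (g : SL n) {k : ℕ} (hk : k ≤ 2 * n) :
    Submodule.span ℂ (Set.range (colFrame g hk).row) = flagSub g k := by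
  apply le_antisymm
  · rw [Submodule.span_le]
    rintro _ ⟨j, rfl⟩
    exact flagSub_le_iff.1 le_rfl (Fin.castLE hk j) j.2
  · rw [flagSub_le_iff]
    exact fun j hj => Submodule.subset_span ⟨⟨j.1, hj⟩, rfl⟩

theorem linearIndependent_colFrame (g : SL n) {k : ℕ} (hk : k ≤ 2 * n) :
    LinearIndependent ℂ (colFrame g hk).row := by
  rw [linearIndependent_iff_card_eq_finrank_span, Set.finrank, span_colFrame,
    finrank_flagSub g hk, Fintype.card_fin]

/-- A frame in `V` depending only on the row span of `A`. -/
noncomputable def windowFrame (i : Set.Icc 1 n) {k : ℕ} (C : Matrix (Fin (2 * n)) (Fin k) ℂ)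
    (K : Matrix (Fin (i : ℕ)) (Fin k) ℂ) (A : Matrix (Fin k) (Fin (2 * n)) ℂ) :
    Matrix (Fin (i : ℕ)) (Fin (n + 1)) ℂ :=
  (K * normFrame A C).submatrix id (scaleIndex i)

theorem span_windowFrame_le (i : Set.Icc 1 n) {k : ℕ} {C : Matrix (Fin (2 * n)) (Fin k) ℂ}
    {K : Matrix (Fin (i : ℕ)) (Fin k) ℂ} {A : Matrix (Fin k) (Fin (2 * n)) ℂ}
    (hA : (A * C).det ≠ 0) : Submodule.span ℂ (Set.range (windowFrame i C K A).row) ≤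
      (Submodule.span ℂ (Set.range A.row)).map (window i) := by
  rw [Submodule.span_le]
  rintro _ ⟨j, rfl⟩
  refine ⟨(K * normFrame A C).row j, ?_, rfl⟩
  rw [← span_normFrame hA]
  exact span_mul_le _ _ (Submodule.subset_span ⟨j, rfl⟩)

theorem exists_windowFrame (l : Fin s) {g : SL n} (hg : IsBounded d g) :
    ∃ (C : Matrix (Fin (2 * n)) (Fin (2 * (d l : ℕ) - 1)) ℂ)
      (K : Matrix (Fin (d l : ℕ)) (Fin (2 * (d l : ℕ) - 1)) ℂ)
      (D : Matrix (Fin (n + 1)) (Fin (d l : ℕ)) ℂ),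
      (colFrame g (flagDim_le d l) * C).det ≠ 0 ∧
      (windowFrame (d l) C K (colFrame g (flagDim_le d l)) * D).det ≠ 0 := by
  obtain ⟨C, hC⟩ := exists_mul_eq_one_of_linearIndependent
    (linearIndependent_colFrame g (flagDim_le d l))
  obtain ⟨A, hA, hAU⟩ := exists_linearIndependent_span_eq (finrank_map_window_flagSub hg l)
  have h : ∀ i, ∃ c : Fin (2 * (d l : ℕ) - 1) → ℂ,
      window (d l) (Matrix.vecMul c (colFrame g (flagDim_le d l))) = A i := by
    intro i
    have h1 : A i ∈ (flagSub g (2 * (d l : ℕ) - 1)).map (window (d l)) := by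
      rw [← hAU]
      exact Submodule.subset_span ⟨i, rfl⟩
    obtain ⟨u, hu, hui⟩ := h1
    rw [← span_colFrame g (flagDim_le d l)] at hu
    obtain ⟨c, rfl⟩ := mem_span_range_iff_vecMul.1 hu
    exact ⟨c, hui⟩
  choose K hK using h
  obtain ⟨D, hD⟩ := exists_mul_eq_one_of_linearIndependent (A := Matrix.of A) hA
  refine ⟨C, Matrix.of K, D, by rw [hC, Matrix.det_one]; exact one_ne_zero, ?_⟩
  have e : windowFrame (d l) C (Matrix.of K) (colFrame g (flagDim_le d l)) = Matrix.of A := by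
    rw [windowFrame, normFrame_of_mul_eq_one hC]
    ext i k
    exact congrFun (hK i) k
  rw [e, hD, Matrix.det_one]
  exact one_ne_zero

theorem toDegFlag_isMorphism (hd : StrictMono d) :
    (schubertVar d (sigmaD d)).IsMorphism (degFlagVar d) (toDegFlag hd) := by
  let : TopologicalSpace (SL n) := (slVar n).top
  refine SpaceWithFunctions.isMorphism_of_local_lift
    (c := fun (g : SL n) (ij : Fin (2 * n) × Fin (2 * n)) => g.1 ij.1 ij.2)
    (c' := fun (A : Frames d) (a : Σ l, Fin (d l : ℕ) × Fin (n + 1)) => (A a.1).1 a.2.1 a.2.2)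
    (π := fun g : SL n => (g : PartialFlag d)) (π' := spanMap d)
    QuotientGroup.mk_surjective (toDegFlag hd) fun g₀ hg₀ => ?_
  have hb₀ := (mk_mem_schubert_iff hd g₀).1 hg₀
  choose C K D hC hD using fun l => exists_windowFrame l hb₀
  obtain ⟨A₀, -⟩ := spanMap_surjective d (toDegFlag hd ⟨(g₀ : PartialFlag d), hg₀⟩).1
  let P : ∀ l, SL n → Matrix (Fin (d l : ℕ)) (Fin (n + 1)) ℂ := fun l g =>
    windowFrame (d l) (C l) (K l) (colFrame g (flagDim_le d l))
  have hreg₁ : ∀ l i j (g : SL n),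
      (slVar n).RegularAt (fun g => colFrame g (flagDim_le d l) i j) g := fun l i j g =>
    SpaceWithFunctions.regularAt_coord _ (j, Fin.castLE (flagDim_le d l) i) g
  have hreg₂ : ∀ l (g : SL n), (slVar n).RegularAt
      (fun g => (colFrame g (flagDim_le d l) * C l).det) g := fun l g =>
    (slVar n).regularAt_det fun i j => (slVar n).regularAt_matrix_mul (B := fun _ => C l)
      (fun i j => hreg₁ l i j g) (fun _ _ => (slVar n).const _ _) i j
  have hregP : ∀ l (g : SL n), (colFrame g (flagDim_le d l) * C l).det ≠ 0 →
      ∀ i k, (slVar n).RegularAt (fun g => P l g i k) g := fun l g hg i k =>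
    (slVar n).regularAt_matrix_mul (A := fun _ => K l) (fun _ _ => (slVar n).const _ _)
      (fun i j => regularAt_normFrame (fun i j => hreg₁ l i j g) hg i j) i (scaleIndex (d l) k)
  let O : Set (SL n) := {g | ∀ l, (colFrame g (flagDim_le d l) * C l).det ≠ 0 ∧
    (P l g * D l).det ≠ 0}
  have hO : IsOpen O := by
    have e : O = ⋂ l, {g | g ∈ {g | g ∈ Set.univ ∧ (colFrame g (flagDim_le d l) * C l).det ≠ 0} ∧
        (P l g * D l).det ≠ 0} := by
      ext g
      simp [O]
    rw [e]
    refine isOpen_iInter_of_finite fun l => SpaceWithFunctions.isOpen_setOf_ne_zero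
      (SpaceWithFunctions.isOpen_setOf_ne_zero isOpen_univ fun g _ => hreg₂ l g) fun g hg => ?_
    exact (slVar n).regularAt_det fun i j => (slVar n).regularAt_matrix_mul (B := fun _ => D l)
      (fun i k => hregP l g hg.2 i k) (fun _ _ => (slVar n).const _ _) i j
  have hLI : ∀ g ∈ O, ∀ l, LinearIndependent ℂ (P l g).row := fun g hg l =>
    linearIndependent_of_det_mul_ne_zero (hg l).2
  classical
  let ψ : SL n → Frames d := fun g l =>
    if h : LinearIndependent ℂ (P l g).row then ⟨(P l g).row, h⟩ else A₀ l
  have hψ : ∀ g ∈ O, ∀ l, (ψ g l).1 = (P l g).row := fun g hg l => by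
    simp only [ψ, dif_pos (hLI g hg l)]
  refine ⟨O, ψ, hO, fun l => ⟨hC l, hD l⟩, ?_, ?_, ?_⟩
  · intro g hg h hgh
    have hs : ∀ l, (colFrame h (flagDim_le d l) * C l).det ≠ 0 ∧ P l g = P l h := fun l => by
      have h1 := (mk_eq_mk_iff d g h).1 hgh l
      rw [← span_colFrame _ (flagDim_le d l), ← span_colFrame _ (flagDim_le d l)] at h1
      obtain ⟨h2, h3⟩ := normFrame_eq_of_span_eq (C l) h1 (hg l).1
      refine ⟨h2, ?_⟩
      simp only [P, windowFrame]
      rw [h3]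
    have hh : h ∈ O := fun l => ⟨(hs l).1, (hs l).2 ▸ (hg l).2⟩
    refine ⟨hh, congrArg (spanMap d) (funext fun l => Subtype.ext ?_)⟩
    rw [hψ g hg, hψ h hh, (hs l).2]
  · rintro g hg ⟨l, i, k⟩
    refine (slVar n).congr _ _ g ?_ (hregP l g (hg l).1 i k)
    filter_upwards [hO.mem_nhds hg] with h hh
    rw [hψ h hh]
    rfl
  · intro g hg hgZ
    have hb := (mk_mem_schubert_iff hd g).1 hgZ
    refine funext fun l => Subtype.ext ?_
    rw [toDegFlag_mk hd g hgZ l]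
    change Submodule.span ℂ (Set.range (ψ g l).1) = _
    refine Submodule.eq_of_le_of_finrank_eq ?_ ?_
    · rw [hψ g hg, ← span_colFrame g (flagDim_le d l)]
      exact span_windowFrame_le (d l) (hg l).1
    · rw [finrank_span_eq_card (ψ g l).2, Fintype.card_fin, finrank_map_window_flagSub hb l]

/-! ### From the degenerate flag variety to the Schubert variety -/

/-- A frame as a matrix. -/
def frameMatrix (A : Frames d) (l : Fin s) : Matrix (Fin (d l : ℕ)) (Fin (n + 1)) ℂ :=
  Matrix.of (A l).1

theorem span_frameMatrix (A : Frames d) (l : Fin s) :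
    Submodule.span ℂ (Set.range (frameMatrix A l).row) = (spanMap d A l).1 := rfl

theorem regularAt_frameMatrix (A : Frames d) (l : Fin s) (i : Fin (d l : ℕ)) (k : Fin (n + 1)) :
    (framesVar d).RegularAt (fun A => frameMatrix A l i k) A :=
  SpaceWithFunctions.regularAt_coord _ (⟨l, i, k⟩ : Σ l, Fin (d l : ℕ) × Fin (n + 1)) A

theorem regularAt_unwindow {X : Type*} (S : SpaceWithFunctions X) (i : Set.Icc 1 n)
    {v : X → V n} {x : X} (hv : ∀ k, S.RegularAt (fun y => v y k) x) (r : Fin (2 * n)) :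
    S.RegularAt (fun y => unwindow i (v y) r) x := by
  by_cases h : ∃ k, scaleIndex i k = r
  · obtain ⟨k, rfl⟩ := h
    have e : (fun y => unwindow i (v y) (scaleIndex i k)) = fun y => v y k :=
      funext fun y => congrFun (window_unwindow i (v y)) k
    rw [e]
    exact hv k
  · have e : (fun y => unwindow i (v y) r) = fun _ => 0 :=
      funext fun y => Function.extend_apply' (v y) (0 : Fin (2 * n) → ℂ) r h
    rw [e]
    exact S.const 0 x

/-- Deformation of a vector of a flag along with the flag. -/
theorem exists_column (hd : StrictMono d) {g₀ : SL n} (hg₀ : IsBounded d g₀) {A₀ : Frames d}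
    (hA₀ : ∀ l, (flagSub g₀ (2 * (d l : ℕ) - 1)).map (window (d l)) = (spanMap d A₀ l).1)
    {C : ∀ l, Matrix (Fin (n + 1)) (Fin (d l : ℕ)) ℂ} (hC : ∀ l, frameMatrix A₀ l * C l = 1)
    (j : Fin (2 * n)) :
    ∃ m : Frames d → Fin (2 * n) → ℂ, (m A₀ = fun i => g₀.1 i j) ∧
      ∀ A : Frames d, (∀ l, (frameMatrix A l * C l).det ≠ 0) →
        (∀ i, (framesVar d).RegularAt (fun A => m A i) A) ∧
        (∀ A', spanMap d A = spanMap d A' → m A = m A') ∧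
        (spanMap d A ∈ degFlag d → ∀ l, j.1 < 2 * (d l : ℕ) - 1 →
          m A ∈ windowComap (d l) (spanMap d A l).1) := by
  set w : Fin (2 * n) → ℂ := fun i => g₀.1 i j with hw
  by_cases hl : ∃ l, j.1 < 2 * (d l : ℕ) - 1
  · obtain ⟨l, hl, hmin⟩ := WellFounded.has_min (wellFounded_lt (α := Fin s))
      {l | j.1 < 2 * (d l : ℕ) - 1} hl
    have hwF : w ∈ flagSub g₀ (2 * (d l : ℕ) - 1) := flagSub_le_iff.1 le_rfl j hl
    have hwV : window (d l) w ∈ (spanMap d A₀ l).1 := hA₀ l ▸ ⟨w, hwF, rfl⟩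
    rw [← span_frameMatrix] at hwV
    obtain ⟨c, hc⟩ := mem_span_range_iff_vecMul.1 hwV
    refine ⟨fun A => w + unwindow (d l)
      (Matrix.vecMul c (normFrame (frameMatrix A l) (C l)) - window (d l) w), ?_, fun A hA => ?_⟩
    · beta_reduce
      rw [normFrame_of_mul_eq_one (hC l), hc, sub_self, map_zero, add_zero]
    refine ⟨fun i => ?_, fun A' hA' => ?_, fun hAd m hm => ?_⟩
    · refine (framesVar d).add _ _ A ((framesVar d).const (w i) A)
        (regularAt_unwindow (framesVar d) (d l) (fun k => ?_) i)
      simp only [Pi.sub_apply, sub_eq_add_neg]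
      refine (framesVar d).add _ _ A ?_ ((framesVar d).const _ A)
      simp only [Matrix.vecMul, dotProduct]
      exact (framesVar d).regularAt_sum _ _ A fun i _ => (framesVar d).mul _ _ A
        ((framesVar d).const (c i) A)
        (regularAt_normFrame (fun a b => regularAt_frameMatrix A l a b) (hA l) i k)
    · have h1 : Submodule.span ℂ (Set.range (frameMatrix A l).row) =
          Submodule.span ℂ (Set.range (frameMatrix A' l).row) := by
        rw [span_frameMatrix, span_frameMatrix, hA']
      simp only [(normFrame_eq_of_span_eq (C l) h1 (hA l)).2]
    · have hlm : l ≤ m := not_lt.1 (hmin m hm)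
      refine windowComap_monotone hd hAd hlm ⟨?_, ?_⟩
      · rw [SetLike.mem_coe, Submodule.mem_comap, map_add, window_unwindow, add_sub_cancel,
          ← span_frameMatrix, ← span_normFrame (hA l)]
        exact mem_span_range_iff_vecMul.2 ⟨c, rfl⟩
      · exact add_mem ((hg₀ l).2 hwF) (unwindow_mem _ _)
  · exact ⟨fun _ => w, rfl, fun A _ => ⟨fun i => (framesVar d).const _ A, fun _ _ => rfl,
      fun _ l hl' => absurd ⟨l, hl'⟩ hl⟩⟩

theorem toDegFlag_symm_isMorphism (hd : StrictMono d) :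
    (degFlagVar d).IsMorphism (schubertVar d (sigmaD d))
      (Equiv.ofBijective _ (toDegFlag_bijective hd)).symm := by
  let : TopologicalSpace (Frames d) := (framesVar d).top
  set ζ := (Equiv.ofBijective _ (toDegFlag_bijective hd)).symm with hζ
  have hζ' : ∀ U, toDegFlag hd (ζ U) = U :=
    (Equiv.ofBijective _ (toDegFlag_bijective hd)).apply_symm_apply
  refine SpaceWithFunctions.isMorphism_of_local_lift
    (c := fun (A : Frames d) (a : Σ l, Fin (d l : ℕ) × Fin (n + 1)) => (A a.1).1 a.2.1 a.2.2)
    (c' := fun (g : SL n) (ij : Fin (2 * n) × Fin (2 * n)) => g.1 ij.1 ij.2)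
    (π := spanMap d) (π' := fun g : SL n => (g : PartialFlag d))
    (spanMap_surjective d) ζ fun A₀ hA₀ => ?_
  have hlift : ∀ (A : Frames d) (hA : spanMap d A ∈ degFlag d), ∃ g : SL n, IsBounded d g ∧
      (g : PartialFlag d) = ζ ⟨spanMap d A, hA⟩ ∧
      ∀ l, (flagSub g (2 * (d l : ℕ) - 1)).map (window (d l)) = (spanMap d A l).1 := by
    intro A hA
    obtain ⟨g, hg⟩ := QuotientGroup.mk_surjective (ζ ⟨spanMap d A, hA⟩).1
    have hgm : (g : PartialFlag d) ∈ schubert d (sigmaD d) := hg ▸ (ζ ⟨spanMap d A, hA⟩).2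
    refine ⟨g, (mk_mem_schubert_iff hd g).1 hgm, hg, fun l => ?_⟩
    have h1 : (⟨g, hgm⟩ : schubert d (sigmaD d)) = ζ ⟨spanMap d A, hA⟩ := Subtype.ext hg
    rw [← toDegFlag_mk hd g hgm l, h1, hζ']
  obtain ⟨g₀, hb₀, -, hg₀⟩ := hlift A₀ hA₀
  choose C hC using fun l => exists_mul_eq_one_of_linearIndependent (A := frameMatrix A₀ l) (A₀ l).2
  choose m hm₀ hm using exists_column hd hb₀ hg₀ hC
  let M : Frames d → Matrix (Fin (2 * n)) (Fin (2 * n)) ℂ := fun A => Matrix.of fun i j => m j A i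
  let O₁ : Set (Frames d) := {A | ∀ l, (frameMatrix A l * C l).det ≠ 0}
  have hO₁ : IsOpen O₁ := by
    have e : O₁ = ⋂ l, {A | A ∈ Set.univ ∧ (frameMatrix A l * C l).det ≠ 0} := by
      ext g
      simp [O₁]
    rw [e]
    refine isOpen_iInter_of_finite fun l => SpaceWithFunctions.isOpen_setOf_ne_zero isOpen_univ
      fun A _ => ?_
    exact (framesVar d).regularAt_det fun i j => (framesVar d).regularAt_matrix_mul
      (B := fun _ => C l) (fun a b => regularAt_frameMatrix A l a b)
      (fun _ _ => (framesVar d).const _ _) i j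
  have hregM : ∀ A ∈ O₁, ∀ i j, (framesVar d).RegularAt (fun A => M A i j) A :=
    fun A hA i j => (hm j A hA).1 i
  have hregdet : ∀ A ∈ O₁, (framesVar d).RegularAt (fun A => (M A).det) A :=
    fun A hA => (framesVar d).regularAt_det (hregM A hA)
  let O : Set (Frames d) := {A | A ∈ O₁ ∧ (M A).det ≠ 0}
  have hO : IsOpen O := SpaceWithFunctions.isOpen_setOf_ne_zero hO₁ hregdet
  classical
  let ψ : Frames d → SL n := fun A => if h : (M A).det ≠ 0 then slOfMatrix (M A) h else 1
  have hψ : ∀ A (hA : A ∈ O), ψ A = slOfMatrix (M A) hA.2 := fun A hA => dif_pos hA.2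
  refine ⟨O, ψ, hO, ⟨fun l => ?_, ?_⟩, ?_, ?_, ?_⟩
  · rw [hC l, Matrix.det_one]
    exact one_ne_zero
  · have e : M A₀ = g₀.1 := by
      ext i j
      exact congrFun (hm₀ j) i
    rw [e, g₀.2]
    exact one_ne_zero
  · intro A hA A' hAA'
    have hA'₁ : A' ∈ O₁ := fun l =>
      (normFrame_eq_of_span_eq (A := frameMatrix A l) (A' := frameMatrix A' l) (C l)
        (by rw [span_frameMatrix, span_frameMatrix, hAA']) (hA.1 l)).1
    have e : M A = M A' := by
      ext i j
      exact congrFun ((hm j A hA.1).2.1 A' hAA') i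
    refine ⟨⟨hA'₁, e ▸ hA.2⟩, ?_⟩
    simp only [ψ, e]
  · rintro A hA ⟨i, j⟩
    have hscale : (framesVar d).RegularAt (fun A => detScale (M A) j) A := by
      unfold detScale
      split_ifs
      · exact (hregdet A hA.1).inv hA.2
      · exact (framesVar d).const _ _
    refine (framesVar d).congr _ _ A ?_ ((framesVar d).mul _ _ A (hregM A hA.1 i j) hscale)
    filter_upwards [hO.mem_nhds hA] with A' hA'
    rw [hψ A' hA', slOfMatrix_apply]
    rfl
  · intro A hA hAd
    obtain ⟨g, hb, hg, hgA⟩ := hlift A hAd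
    rw [← hg, mk_eq_mk_iff]
    intro l
    rw [hψ A hA]
    refine flagSub_slOfMatrix_eq hA.2 (flagDim_le d l) (finrank_flagSub g (flagDim_le d l))
      fun j hj => ?_
    rw [← windowComap_flagSub hb l, hgA l]
    exact (hm j A hA.1).2.2 hAd l hj

end Morphisms

end DegFlag

/-- For `1 ≤ d_1 < ... < d_s ≤ n` there is a `T`-equivariant isomorphism of varieties from the
partial degenerate flag variety onto the Schubert variety `X_{σ_d}` in `SL_{2n} / P_λ`. -/
theorem theorem3p1 (n s : ℕ) (d : Fin s → Set.Icc 1 n) (hd : StrictMono d) :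
    ∃ ζ : DegFlag.degFlag d ≃ DegFlag.schubert d (DegFlag.sigmaD d),
      (DegFlag.degFlagVar d).IsIso (DegFlag.schubertVar d (DegFlag.sigmaD d)) ζ ∧
      ∀ (t : DegFlag.torus n) (U : DegFlag.degFlag d),
        ζ (DegFlag.actDegFlag d hd t U) =
          DegFlag.actSchubert d (DegFlag.sigmaD d) t (ζ U) := by
  refine ⟨(Equiv.ofBijective _ (DegFlag.toDegFlag_bijective hd)).symm,
    ⟨DegFlag.toDegFlag_symm_isMorphism hd, DegFlag.toDegFlag_isMorphism hd⟩, fun t U => ?_⟩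
  rw [Equiv.symm_apply_eq, Equiv.ofBijective_apply, DegFlag.toDegFlag_actSchubert]
  congr 1
  exact ((Equiv.ofBijective _ (DegFlag.toDegFlag_bijective hd)).apply_symm_apply U).symm
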